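/- Let $d\ge 2$ and $0<\varepsilon<1$. In the $d$-dimensional multiple-choice knapsack problem ($d$MCKS) we are given a finite set $\mathcal I$ of pairwise disjoint finite itemsets. Each item $i$ is a cuboid with side lengths $\ell_1(i),\dots,\ell_d(i)\in(0,1]$ and has a profit $p(i)\ge 0$. A feasible solution picks at most one item from each itemset, together with a packing of the picked items, without rotation, into the unit cube $[0,1]^d$ so that no two items overlap (intersect in positive volume). The aim is to maximize the total profit. A feasible solution is $\alpha$-approximate if its profit is at least $\alpha$ times the optimum. *Notation.* Let $\operatorname{type}(x)=q$ for $x\in(\frac1{q+1},\frac1q]$, $q\in\{1,2\}$, and $\operatorname{type}(x)=3$ for $x\le\frac13$. Let $f(x)=1/q$ if $\operatorname{type}(x)=q\in\{1,2\}$, and $f(x)=3x$ if $x\le \frac13$. Let $T$ be the smallest positive constant such that $H:=f/T$ is a weighting function, i.e. $H$ maps $[0,1]$ to $[0,1]$ and $\sum_r H(x_r)\le 1$ whenever $x_1,\dots,x_s\in[0,1]$ and $\sum_r x_r\le 1$. For an item $i$ let $v(i)=\ell_d(i)\prod_{j<d}H(\ell_j(i))$. The base type of $i$ is the vector $(\operatorname{type}(\ell_j(i)))_{j<d}$,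 and its base weight is $\prod_{j<d}f(\ell_j(i))$. To *cut* a sequence of items into shelves is to remove repeatedly the smallest initial segment that has total base weight at least $1$ or is the whole remaining sequence; each segment forms a shelf, whose height is the largest $\ell_d$ in it. *Unit-pack* of a sequence of items, all of the same type vector $(t_1,\dots,t_d)$: if $d=1$, lay the items side by side. If $d>1$, sort the sequence by non-increasing $\ell_d$ if $t_d=3$ (otherwise keep the order), cut it into shelves, pack the bases of the items of each shelf by $(d-1)$-dimensional unit-pack, and stack the shelves. *HDH-NF* (a bin packing of a set of items): for each base type, sort the items of that base type by non-increasing $\ell_d$, cut them into shelves, and pack the base of each shelf by unit-pack. The first shelf of each base type gets a bin of its own; all other shelves are packed into bins by Next-Fit according to their heights. *HDH-KS*: (1) form the one-dimensional multiple-choice knapsack instance $\widehat{\mathcal I}$ with capacity $1$, with the same itemsets and profits, in which item $i$ has size $v(i)$; (2) solve $\widehat{\mathcal I}$ by Lawler's approximation scheme with parameter $\varepsilon$, that is, with $n=|\mathcal I|$ and $P_0$ the larger of the largest single profit and the profit of the greedy algorithm for the linear relaxation, use the dynamic program over undominated pairs (rounded profit, size) for the rounded profits $\lfloor p(i)/K\rfloor$,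 $K=\varepsilon P_0/n$ (if $K=0$, all rounded profits are taken to be $0$); (3) pack the chosen items by HDH-NF; (4) return a most profitable bin (the empty bin if there are none). **Theorem.** HDH-KS is $(1-\varepsilon)3^{-d}$-approximate for $d$MCKS: on every instance it returns a feasible solution (with its packing) whose profit is at least $(1-\varepsilon)3^{-d}$ times the optimum. More precisely, Lawler's scheme returns a $(1-\varepsilon)$-approximate solution of $\widehat{\mathcal I}$, and for every $(1-\varepsilon)$-approximate solution $J$ of $\widehat{\mathcal I}$, HDH-NF produces a valid packing of $J$ into at most $3^d$ bins, and a most profitable one of these bins (the one step (4) selects) is a $(1-\varepsilon)3^{-d}$-approximate solution of the $d$MCKS instance. -/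

import Mathlib

noncomputable section

/-! ### Weighting functions and the harmonic function -/

/-- `g` maps `[0,1]` to `[0,1]`, and whenever finitely many numbers of `[0,1]` sum to at most `1`,
so do their images (a dual feasible function). -/
def IsWeightingFunction (g : ℝ → ℝ) : Prop :=
  (∀ x ∈ Set.Icc (0 : ℝ) 1, g x ∈ Set.Icc (0 : ℝ) 1) ∧
    ∀ (m : ℕ) (x : Fin m → ℝ), 0 < m → (∀ i, x i ∈ Set.Icc (0 : ℝ) 1) →
      ∑ i, x i ≤ 1 → ∑ i, g (x i) ≤ 1

/-- `type_k(x)`: it is `k` if `x ≤ 1/k`, and otherwise the `q` with `1/(q+1) < x ≤ 1/q`,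
which is `q = ⌊1/x⌋`. -/
def harmonicType (k : ℕ) (x : ℝ) : ℕ :=
  if x ≤ 1 / (k : ℝ) then k else ⌊1 / x⌋₊

/-- `f_k(x)`: it is `k x / (k - 2)` if `x ≤ 1/k`, and `1/q` if `1/(q+1) < x ≤ 1/q` with `q < k`. -/
def harmonicF (k : ℕ) (x : ℝ) : ℝ :=
  if x ≤ 1 / (k : ℝ) then (k : ℝ) / ((k : ℝ) - 2) * x else 1 / (harmonicType k x : ℝ)

/-- `T_k`: the smallest positive constant `T` for which `f_k / T` is a weighting function. -/
def harmonicT (k : ℕ) : ℝ :=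
  sInf {T : ℝ | 0 < T ∧ IsWeightingFunction (fun x => harmonicF k x / T)}

/-- The harmonic weighting function `H_k = f_k / T_k`. -/
def harmonicH (k : ℕ) (x : ℝ) : ℝ := harmonicF k x / harmonicT k

/-- The volume of a cuboid, given by its side lengths. -/
def cuboidVol {d : ℕ} (x : Fin d → ℝ) : ℝ := ∏ j, x j

/-- Apply `g` to every side length but the last one (the height). With `g = H_k` this is the
transformation `i ↦ H̃_k(i)`. -/
def mapBase {m : ℕ} (g : ℝ → ℝ) (x : Fin (m + 1) → ℝ) : Fin (m + 1) → ℝ :=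
  fun j => if j = Fin.last m then x j else g (x j)

/-- The side lengths of an item in its base dimensions (all but the last). -/
def baseLen {ι : Type*} {m : ℕ} (len : ι → Fin (m + 1) → ℝ) : ι → Fin m → ℝ :=
  fun i j => len i j.castSucc

/-! ### Packings and the `d`-dimensional multiple-choice knapsack problem -/

/-- The items of `S`, with side lengths `len`, translated to the positions `pos`, form a packing
into the unit cube `[0,1]^d`: each lies in the cube, and no two of them overlap, that is, the
intersection of any two has volume zero. Rotations are not allowed. -/
def IsPacking {ι : Type*} {d : ℕ} (len : ι → Fin d → ℝ) (S : Finset ι)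
    (pos : ι → Fin d → ℝ) : Prop :=
  (∀ i ∈ S, Set.Icc (pos i) (pos i + len i) ⊆ Set.Icc 0 1) ∧
    ∀ i ∈ S, ∀ i' ∈ S, i ≠ i' →
      MeasureTheory.volume
        (Set.Icc (pos i) (pos i + len i) ∩ Set.Icc (pos i') (pos i' + len i')) = 0

/-- The choice constraint: `S` consists of items of the itemsets, at most one from each. -/
def IsChoice {ι : Type*} [DecidableEq ι] (itemsets : Finset (Finset ι)) (S : Finset ι) : Prop :=
  S ⊆ itemsets.biUnion id ∧ ∀ I ∈ itemsets, (S ∩ I).card ≤ 1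

/-- The data of an instance of the `d`-dimensional multiple-choice knapsack problem: a finite set
of itemsets, and for each item its side lengths and its profit. -/
structure MCKS (ι : Type*) (d : ℕ) where
  itemsets : Finset (Finset ι)
  len : ι → Fin d → ℝ
  profit : ι → ℝ

/-- The standing assumptions on an instance: different itemsets share no item, side lengths are
positive and at most `1`, profits are nonnegative. -/
structure MCKS.IsValid {ι : Type*} {d : ℕ} (P : MCKS ι d) : Prop where
  disjoint : ∀ I ∈ P.itemsets, ∀ I' ∈ P.itemsets, I ≠ I' → Disjoint I I'
  len_pos : ∀ I ∈ P.itemsets, ∀ i ∈ I, ∀ j, 0 < P.len i j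
  len_le_one : ∀ I ∈ P.itemsets, ∀ i ∈ I, ∀ j, P.len i j ≤ 1
  profit_nonneg : ∀ I ∈ P.itemsets, ∀ i ∈ I, 0 ≤ P.profit i

/-- A candidate solution: the packed items, with a position for each. -/
structure PackedBin (ι : Type*) (d : ℕ) where
  items : Finset ι
  pos : ι → Fin d → ℝ

/-- A feasible solution: at most one item of each itemset, packed into the unit cube. -/
def MCKS.IsFeasible {ι : Type*} [DecidableEq ι] {d : ℕ} (P : MCKS ι d)
    (B : PackedBin ι d) : Prop :=
  IsChoice P.itemsets B.items ∧ IsPacking P.len B.items B.pos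

/-- A feasible solution whose profit is at least `α` times that of every feasible solution, hence
at least `α` times the optimum. -/
def MCKS.IsApproxSolution {ι : Type*} [DecidableEq ι] {d : ℕ} (P : MCKS ι d) (α : ℝ)
    (B : PackedBin ι d) : Prop :=
  P.IsFeasible B ∧
    ∀ B', P.IsFeasible B' → α * ∑ i ∈ B'.items, P.profit i ≤ ∑ i ∈ B.items, P.profit i

/-! ### One-dimensional multiple-choice knapsack and Lawler's approximation scheme -/

/-- The data of an instance of the one-dimensional multiple-choice knapsack problem, with a
knapsack of capacity `1`. -/
structure MCKS1 (ι : Type*) where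
  itemsets : Finset (Finset ι)
  size : ι → ℝ
  profit : ι → ℝ

namespace MCKS1

variable {ι : Type*} [DecidableEq ι]

/-- The total size of a set of items. -/
def totalSize (P : MCKS1 ι) (S : Finset ι) : ℝ := ∑ i ∈ S, P.size i

/-- The total profit of a set of items. -/
def totalProfit (P : MCKS1 ι) (S : Finset ι) : ℝ := ∑ i ∈ S, P.profit i

/-- A feasible solution: at most one item of each itemset, of total size at most `1`. -/
def IsFeasible (P : MCKS1 ι) (S : Finset ι) : Prop :=
  IsChoice P.itemsets S ∧ P.totalSize S ≤ 1

/-- A feasible solution whose profit is at least `α` times the optimum. -/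
def IsApproxSolution (P : MCKS1 ι) (α : ℝ) (S : Finset ι) : Prop :=
  P.IsFeasible S ∧ ∀ S', P.IsFeasible S' → α * P.totalProfit S' ≤ P.totalProfit S

/-- All pairs of an itemset and an item in it. -/
def allItems (P : MCKS1 ι) : List (Finset ι × ι) :=
  P.itemsets.toList.flatMap fun I => I.toList.map fun i => (I, i)

/-- The profit gained by making `c.2` the chosen item of the itemset `c.1`. -/
def gain (P : MCKS1 ι) (S : Finset ι) (c : Finset ι × ι) : ℝ :=
  P.profit c.2 - P.totalProfit (S ∩ c.1)

/-- The size added by making `c.2` the chosen item of the itemset `c.1`. -/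
def added (P : MCKS1 ι) (S : Finset ι) (c : Finset ι × ι) : ℝ :=
  P.size c.2 - P.totalSize (S ∩ c.1)

/-- Make `c.2` the chosen item of the itemset `c.1`. -/
def exchange (S : Finset ι) (c : Finset ι × ι) : Finset ι := insert c.2 (S \ c.1)

/-- The exchanges that raise both profit and size. -/
def upgrades (P : MCKS1 ι) (S : Finset ι) : List (Finset ι × ι) :=
  P.allItems.filter fun c => decide (0 < P.gain S c ∧ 0 < P.added S c)

/-- The greedy algorithm for the linear relaxation, for at most `t` rounds: always perform the
exchange with the largest ratio of gained profit to added size (so that in each itemset one moves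
along the upper convex hull of its items), until the next exchange no longer fits. -/
def greedy (P : MCKS1 ι) : ℕ → Finset ι → Finset ι
  | 0, S => S
  | t + 1, S =>
    match (P.upgrades S).argmax (fun c => P.gain S c / P.added S c) with
    | none => S
    | some c => if P.totalSize (exchange S c) ≤ 1 then greedy P t (exchange S c) else S

/-- The larger of the greedy profit and the largest profit of a single item. The optimum lies
between this number and twice this number. -/
def lowerBound (P : MCKS1 ι) : ℝ :=
  max ((P.allItems.map fun c => P.profit c.2).foldr max 0)
    (P.totalProfit (P.greedy P.allItems.length ∅))

/-- The unit `K = ε P₀ / n` in which profits are measured, where `P₀` is the lower bound and `n`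
the number of itemsets. -/
def scale (P : MCKS1 ι) (ε : ℝ) : ℝ := ε * P.lowerBound / (P.itemsets.card : ℝ)

/-- The total scaled and rounded profit `∑ ⌊p(i)/K⌋`. -/
def scaledProfit (P : MCKS1 ι) (ε : ℝ) (S : Finset ι) : ℕ :=
  ∑ i ∈ S, ⌊P.profit i / P.scale ε⌋₊

/-- `S` dominates `S'`: at least the same scaled profit at no greater size. -/
def Dominates (P : MCKS1 ι) (ε : ℝ) (S S' : Finset ι) : Prop :=
  P.scaledProfit ε S' ≤ P.scaledProfit ε S ∧ P.totalSize S ≤ P.totalSize S'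

open Classical in
/-- Add `S` to the list of undominated states, unless it exceeds the capacity or is dominated;
states dominated by `S` are removed. -/
def insertState (P : MCKS1 ι) (ε : ℝ) (L : List (Finset ι)) (S : Finset ι) :
    List (Finset ι) :=
  if 1 < P.totalSize S ∨ ∃ S' ∈ L, P.Dominates ε S' S then L
  else S :: L.filter fun S' => decide (¬ P.Dominates ε S S')

/-- One stage of the dynamic program: extend each state by no item or by one item of `I`, and keep
the undominated states. -/
def stage (P : MCKS1 ι) (ε : ℝ) (L : List (Finset ι)) (I : Finset ι) : List (Finset ι) :=
  (L ++ L.flatMap fun S => I.toList.map fun i => insert i S).foldl (P.insertState ε) []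

/-- Lawler's fully polynomial approximation scheme for one-dimensional multiple-choice knapsack:
a dynamic program over the undominated pairs of scaled profit and size. -/
def lawler (P : MCKS1 ι) (ε : ℝ) : Finset ι :=
  (((P.itemsets.toList.foldl (P.stage ε) [∅]).argmax (P.scaledProfit ε)).getD ∅)

end MCKS1

/-! ### Shelves and the algorithm `HDH-NF` -/

/-- A shelf of height `height` in a bin with `m` base dimensions: the items in it, and the positions
of the items in the base dimensions. Every item stands on the bottom of the shelf. -/
structure HarmonicShelf (ι : Type*) (m : ℕ) where
  items : List ι
  height : ℝ
  pos : ι → Fin m → ℝ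

section Algorithm

variable {ι : Type*} [DecidableEq ι]

/-- The positions of the items when shelves are stacked on top of each other, starting at
height `y`. -/
def stackPos {m : ℕ} : ℝ → List (HarmonicShelf ι m) → ι → Fin (m + 1) → ℝ
  | _, [], _ => 0
  | y, S :: L, i =>
    if i ∈ S.items then Fin.snoc (α := fun _ => ℝ) (S.pos i) y
    else stackPos (y + S.height) L i

/-- Cut a sequence into consecutive groups: repeatedly remove the smallest initial segment `J` that
has weight `w(J) ≥ 1` or exhausts the sequence. Here `c` is the weight already collected for the
group under construction, so one starts with `c = 0`. -/
def cutGroups (w : ι → ℝ) : ℝ → List ι → List (List ι)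
  | _, [] => []
  | c, a :: l =>
    if 1 ≤ c + w a then [a] :: cutGroups w 0 l
    else
      match cutGroups w (c + w a) l with
      | [] => [[a]]
      | g :: gs => (a :: g) :: gs

/-- Sort by non-increasing height. -/
def sortByHeight {m : ℕ} (len : ι → Fin (m + 1) → ℝ) (I : List ι) : List ι :=
  I.mergeSort fun a b => decide (len b (Fin.last m) ≤ len a (Fin.last m))

/-- The largest height of an item of `J`. -/
def maxHeight {m : ℕ} (len : ι → Fin (m + 1) → ℝ) (J : List ι) : ℝ :=
  (J.map fun i => len i (Fin.last m)).foldr max 0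

/-- `vol(f_k(i^{(d-1)}))`: the transformed volume of the base of an item. -/
def baseWeight (k : ℕ) {m : ℕ} (len : ι → Fin (m + 1) → ℝ) (i : ι) : ℝ :=
  cuboidVol fun j => harmonicF k (baseLen len i j)

/-- `HDH-unit-pack_k`, in dimension `m + 1`, for a sequence `I` of items of type `t`: the positions
it gives to the items. In dimension one the items are laid side by side. In a higher dimension the
sequence is sorted by height if `t_d = k`, then cut into shelves, each shelf is packed recursively,
and the shelves are stacked. -/
def hdhUnitPack (k : ℕ) :
    (m : ℕ) → (ι → Fin (m + 1) → ℝ) → (Fin (m + 1) → ℕ) → List ι → ι → Fin (m + 1) → ℝ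
  | 0, len, _, I => fun i _ => ((I.takeWhile fun a => decide (a ≠ i)).map fun a => len a 0).sum
  | m + 1, len, t, I =>
    stackPos 0
      ((cutGroups (baseWeight k len) 0
          (if t (Fin.last (m + 1)) = k then sortByHeight len I else I)).map fun J =>
        { items := J
          height := maxHeight len J
          pos := hdhUnitPack k m (baseLen len) (fun j => t j.castSucc) J })

/-- The base type of an item: the vector of the types of its base dimensions. -/
def baseType (k : ℕ) {m : ℕ} (len : ι → Fin (m + 1) → ℝ) (i : ι) : Fin m → ℕ :=
  fun j => harmonicType k (baseLen len i j)

/-- The shelves of base type `t` made by `HDH-SP_k` in dimension `m + 2`, in the order in which they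
are made (which is by non-increasing height). -/
def hdhShelves (k : ℕ) {m : ℕ} (len : ι → Fin (m + 2) → ℝ) (I : List ι)
    (t : Fin (m + 1) → ℕ) : List (HarmonicShelf ι (m + 1)) :=
  (cutGroups (baseWeight k len) 0
      (sortByHeight len (I.filter fun i => decide (baseType k len i = t)))).map fun J =>
    { items := J
      height := maxHeight len J
      pos := hdhUnitPack k m (baseLen len) t J }

/-- Next-Fit with current bin `B`: a shelf goes into the current bin if it fits, and otherwise this
bin is closed and the shelf opens a new one. -/
def nextFitFrom {m : ℕ} : List (HarmonicShelf ι m) → List (HarmonicShelf ι m) → List (List (HarmonicShelf ι m))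
  | B, [] => [B]
  | B, S :: L =>
    if (B.map HarmonicShelf.height).sum + S.height ≤ 1 then nextFitFrom (B ++ [S]) L
    else B :: nextFitFrom [S] L

/-- Next-Fit packing of shelves, as one-dimensional items, into bins of capacity `1`. -/
def nextFit {m : ℕ} : List (HarmonicShelf ι m) → List (List (HarmonicShelf ι m))
  | [] => []
  | S :: L => nextFitFrom [S] L

/-- The packed bin that consists of a stack of shelves. -/
def stackBin {m : ℕ} (B : List (HarmonicShelf ι m)) : PackedBin ι (m + 1) where
  items := (B.flatMap HarmonicShelf.items).toFinset
  pos := stackPos 0 B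

/-- `HDH-NF_k`: a bin packing of the items `I`. For each base type, the first shelf gets a bin of
its own; all other shelves are packed by Next-Fit. -/
def hdhNF (k : ℕ) {m : ℕ} (len : ι → Fin (m + 2) → ℝ) (I : List ι) :
    List (PackedBin ι (m + 2)) :=
  let shelves := ((I.map (baseType k len)).dedup).map (hdhShelves k len I)
  ((shelves.filterMap List.head?).map (fun S => [S]) ++ nextFit (shelves.flatMap List.tail)).map
    stackBin

/-- `L` is a packing of the items `J` into bins: every bin is packed correctly, and every item of
`J` lies in exactly one bin. -/
def IsBinPacking {d : ℕ} (len : ι → Fin d → ℝ) (J : Finset ι) (L : List (PackedBin ι d)) : Prop :=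
  (∀ B ∈ L, IsPacking len B.items B.pos) ∧
    L.Pairwise (fun B B' => Disjoint B.items B'.items) ∧
    ∀ i, i ∈ J ↔ ∃ B ∈ L, i ∈ B.items

/-! ### The algorithm `HDH-KS` -/

/-- The reduction to one dimension: the item `i` is replaced by a one-dimensional item of size
`vol(H̃_3(i))`, with the same profit. -/
def MCKS.reduce {m : ℕ} (P : MCKS ι (m + 1)) : MCKS1 ι where
  itemsets := P.itemsets
  size := fun i => cuboidVol (mapBase (harmonicH 3) (P.len i))
  profit := P.profit

/-- A most profitable bin of a list of bins (the empty bin if there are none). -/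
def mostProfitable {d : ℕ} (profit : ι → ℝ) (L : List (PackedBin ι d)) : PackedBin ι d :=
  (L.argmax fun B => ∑ i ∈ B.items, profit i).getD { items := ∅, pos := 0 }

/-- The part of `HDH-KS` after the one-dimensional problem has been solved by `J`: pack the items of
`J` by `HDH-NF_3` and return a most profitable bin. -/
def MCKS.packBest {m : ℕ} (P : MCKS ι (m + 2)) (J : Finset ι) : PackedBin ι (m + 2) :=
  mostProfitable P.profit (hdhNF 3 P.len J.toList)

/-- The algorithm `HDH-KS` with accuracy parameter `ε`. -/
def MCKS.hdhKS {m : ℕ} (P : MCKS ι (m + 2)) (ε : ℝ) : PackedBin ι (m + 2) :=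
  P.packBest (P.reduce.lawler ε)

end Algorithm

end

/-!
The side lengths in the base dimensions are replaced by `H = f / 3`, where `f` is the harmonic
function. Since `H x ≤ x`, the reduced size `v` of an item is at most its volume, so the items of
every feasible packing form a feasible solution of the one-dimensional instance.

Conversely, cutting a sequence of items of one base type at base weight `1` gives shelves whose
bases can be packed by unit-pack. In the sequence sorted by height, each shelf but the first is at
most as high as every item of the shelf before it, which has base weight at least `1`; so the
heights of these shelves sum to at most `∑ i, w i * h i`, where `w` is the base weight and `h` the
height. If `d` is the dimension, then `w i * h i = 3 ^ (d - 1) * v i`, and the chosen items have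
total reduced size at most `1`; hence Next-Fit, which closes a bin only when two consecutive bins
hold total height more than `1`, needs at most `2 * 3 ^ (d - 1)` bins for these shelves. The first
shelves take one bin for each of the at most `3 ^ (d - 1)` base types. One of these at most `3 ^ d`
bins carries at least the average profit.

Rounding profits down to multiples of `K = ε P₀ / n` loses at most `K` for each of the at most `n`
chosen items, hence at most `ε P₀` in total, and `P₀` is attained up to that loss as well.
-/

noncomputable section

/-! ### Sums and maxima over lists -/

section Lists

variable {ι : Type*}

theorem foldr_max_le_iff {α : Type*} [LinearOrder α] {l : List α} {a b : α} :
    l.foldr max a ≤ b ↔ a ≤ b ∧ ∀ x ∈ l, x ≤ b := by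
  induction l with
  | nil => simp
  | cons x l ih => rw [List.foldr_cons, max_le_iff, ih, List.forall_mem_cons]; tauto

theorem sum_map_nonneg {f : ι → ℝ} {l : List ι} (hf : ∀ i ∈ l, 0 ≤ f i) : 0 ≤ (l.map f).sum :=
  List.sum_nonneg (List.forall_mem_map.2 hf)

theorem sum_map_le_length_mul {f : ι → ℝ} {l : List ι} {c : ℝ} (hf : ∀ i ∈ l, f i ≤ c) :
    (l.map f).sum ≤ l.length * c := by
  simpa using List.sum_le_card_nsmul (l.map f) c (List.forall_mem_map.2 hf)

theorem sum_map_le_add_of_sum_dropLast_le {f : ι → ℝ} {l : List ι} {a c : ℝ} (hc : 0 ≤ c)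
    (hf : ∀ i ∈ l, f i ≤ c) (h : (l.dropLast.map f).sum ≤ a) : (l.map f).sum ≤ a + c := by
  rcases l.eq_nil_or_concat with rfl | ⟨l, i, rfl⟩
  · simpa using add_le_add h hc
  · rw [List.concat_eq_append] at *
    simp only [List.dropLast_concat, List.map_append, List.sum_append, List.map_singleton,
      List.sum_singleton] at h ⊢
    exact add_le_add h (hf i (by simp))

theorem le_sum_map_mul_of_one_le_sum {w h : ι → ℝ} {l : List ι} {c : ℝ} (hw : ∀ i ∈ l, 0 ≤ w i)
    (hc : 0 ≤ c) (hh : ∀ i ∈ l, c ≤ h i) (h1 : 1 ≤ (l.map w).sum) :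
    c ≤ (l.map fun i => w i * h i).sum :=
  calc c ≤ (l.map w).sum * c := le_mul_of_one_le_left hc h1
    _ = (l.map fun i => w i * c).sum := (List.sum_map_mul_right ..).symm
    _ ≤ _ := List.sum_le_sum fun i hi => mul_le_mul_of_nonneg_left (hh i hi) (hw i hi)

theorem flatMap_filter_eq_perm {κ : Type*} [DecidableEq κ] (f : ι → κ) {ts : List κ}
    (hts : ts.Nodup) {l : List ι} (hl : ∀ i ∈ l, f i ∈ ts) :
    (ts.flatMap fun t => l.filter fun i => decide (f i = t)).Perm l := by
  induction ts generalizing l with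
  | nil => rw [List.eq_nil_iff_forall_not_mem.2 fun i hi => List.not_mem_nil (hl i hi)]; rfl
  | cons t ts ih =>
    rw [List.nodup_cons] at hts
    have hrest : (ts.flatMap fun s => l.filter fun i => decide (f i = s)) =
        ts.flatMap fun s => (l.filter fun i => !decide (f i = t)).filter fun i =>
          decide (f i = s) := by
      refine List.flatMap_congr fun s hs => ?_
      rw [List.filter_filter]
      refine List.filter_congr fun i _ => ?_
      have : s ≠ t := fun h => hts.1 (h ▸ hs)
      by_cases h : f i = s <;> simp [h, this]
    rw [List.flatMap_cons, hrest]
    refine ((ih hts.2 fun i hi => ?_).append_left _).trans (List.filter_append_perm _ l)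
    obtain ⟨hil, hit⟩ := List.mem_filter.1 hi
    exact (List.mem_cons.1 (hl i hil)).resolve_left (by simpa using hit)

theorem filterMap_head?_append_flatMap_tail_perm {α : Type*} (L : List (List α)) :
    (L.filterMap List.head? ++ L.flatMap List.tail).Perm L.flatten := by
  induction L with
  | nil => simp
  | cons l L ih =>
    cases l with
    | nil => simpa [List.filterMap_cons] using ih
    | cons a l =>
      simp only [List.filterMap_cons, List.head?_cons, List.flatMap_cons, List.tail_cons,
        List.flatten_cons, List.cons_append, List.perm_cons]
      calc (L.filterMap List.head? ++ (l ++ L.flatMap List.tail)).Perm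
            (l ++ (L.filterMap List.head? ++ L.flatMap List.tail)) := by
              rw [← List.append_assoc, ← List.append_assoc]
              exact List.perm_append_comm.append_right _
        List.Perm _ (l ++ L.flatten) := ih.append_left l

end Lists

/-! ### The harmonic function -/

section Harmonic

variable {k : ℕ} {x : ℝ}

theorem harmonicType_of_le (h : x ≤ 1 / k) : harmonicType k x = k := if_pos h

theorem harmonicType_of_lt (h : 1 / k < x) : harmonicType k x = ⌊1 / x⌋₊ := if_neg h.not_ge

theorem harmonicF_of_le (h : x ≤ 1 / k) : harmonicF k x = k / (k - 2) * x := if_pos h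

theorem harmonicF_of_lt (h : 1 / k < x) : harmonicF k x = 1 / harmonicType k x := if_neg h.not_ge

theorem harmonicType_lt_iff (hk : 0 < k) : harmonicType k x < k ↔ 1 / k < x := by
  have hk' : (0 : ℝ) < 1 / k := by positivity
  refine ⟨fun h => ?_, fun h => ?_⟩
  · contrapose! h
    exact (harmonicType_of_le h).ge
  · have hx : 0 < x := hk'.trans h
    rw [harmonicType_of_lt h, Nat.floor_lt (by positivity)]
    exact (one_div_lt (by positivity) hx).1 h

theorem harmonicType_le (hk : 0 < k) : harmonicType k x ≤ k := by
  rcases le_or_gt x (1 / k) with h | h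
  · exact (harmonicType_of_le h).le
  · exact ((harmonicType_lt_iff hk).2 h).le

theorem harmonicType_pos (hk : 0 < k) (hx : x ≤ 1) : 0 < harmonicType k x := by
  rcases le_or_gt x (1 / k) with h | h
  · rwa [harmonicType_of_le h]
  · have hx0 : 0 < x := lt_of_le_of_lt (by positivity) h
    rw [harmonicType_of_lt h, Nat.floor_pos]
    exact (one_le_div hx0).2 hx

theorem le_one_div_harmonicType (hx : x ≤ 1) : x ≤ 1 / harmonicType k x := by
  rcases le_or_gt x (1 / k) with h | h
  · rwa [harmonicType_of_le h]
  · have hx0 : 0 < x := lt_of_le_of_lt (by positivity) h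
    have hq : (0 : ℝ) < ⌊1 / x⌋₊ := Nat.cast_pos.2 (Nat.floor_pos.2 ((one_le_div hx0).2 hx))
    rw [harmonicType_of_lt h]
    exact (le_one_div hx0 hq).2 (Nat.floor_le (by positivity))

theorem one_lt_harmonicType_add_one_mul (h : 1 / k < x) : 1 < (harmonicType k x + 1) * x := by
  have hx0 : 0 < x := lt_of_le_of_lt (by positivity) h
  rw [harmonicType_of_lt h, ← div_lt_iff₀ hx0]
  exact Nat.lt_floor_add_one _

theorem harmonicF_mem_Icc (hk : 3 ≤ k) (hx : x ∈ Set.Icc 0 1) :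
    harmonicF k x ∈ Set.Icc 0 (min 1 (3 * x)) := by
  have hk3 : (3 : ℝ) ≤ k := by exact_mod_cast hk
  have hk2 : (0 : ℝ) < k - 2 := by linarith
  rw [Set.mem_Icc, le_min_iff]
  rcases le_or_gt x (1 / k) with h | h
  · have hkx : k * x ≤ 1 := by rwa [le_div_iff₀' (by positivity)] at h
    rw [harmonicF_of_le h, div_mul_eq_mul_div]
    refine ⟨div_nonneg (mul_nonneg k.cast_nonneg hx.1) hk2.le, ?_, ?_⟩
    · rw [div_le_one hk2]; linarith
    · rw [div_le_iff₀ hk2]; nlinarith [hx.1]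
  · have hq : (1 : ℝ) ≤ harmonicType k x := by exact_mod_cast harmonicType_pos (by omega) hx.2
    have hqx := one_lt_harmonicType_add_one_mul h
    rw [harmonicF_of_lt h]
    refine ⟨by positivity, (div_le_one (by positivity)).2 hq, ?_⟩
    rw [div_le_iff₀ (by positivity)]
    nlinarith [hx.1]

theorem harmonicT_three : harmonicT 3 = 3 := by
  refine IsLeast.csInf_eq ⟨⟨by norm_num, fun x hx => ?_, fun m x _ hx hs => ?_⟩, ?_⟩
  · obtain ⟨h0, h1⟩ := harmonicF_mem_Icc le_rfl hx
    rw [le_min_iff] at h1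
    exact ⟨by positivity, by linarith⟩
  · refine (Finset.sum_le_sum fun i _ => ?_).trans hs
    have := (le_min_iff.1 (harmonicF_mem_Icc le_rfl (hx i)).2).2
    linarith
  · rintro T ⟨hT, -, hsum⟩
    have hf : harmonicF 3 (1 / 3) = 1 := by norm_num [harmonicF]
    have h3 := hsum 3 (fun _ => 1 / 3) (by norm_num) (fun _ => by norm_num) (by norm_num)
    simp only [hf, Finset.sum_const, Finset.card_univ, Fintype.card_fin, nsmul_eq_mul,
      mul_one_div, div_le_one hT] at h3
    exact_mod_cast h3

theorem harmonicH_three (x : ℝ) : harmonicH 3 x = harmonicF 3 x / 3 := by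
  rw [harmonicH, harmonicT_three]

theorem harmonicH_three_mem_Icc (hx : x ∈ Set.Icc 0 1) : harmonicH 3 x ∈ Set.Icc 0 x := by
  obtain ⟨h0, h1⟩ := harmonicF_mem_Icc le_rfl hx
  rw [le_min_iff] at h1
  rw [harmonicH_three]
  exact ⟨by positivity, by linarith⟩

/-- The harmonic function extended multiplicatively to side-length vectors; it equals
`baseWeight` on bases. -/
def harmonicWeight (k : ℕ) {d : ℕ} (x : Fin d → ℝ) : ℝ := ∏ j, harmonicF k (x j)

variable {d : ℕ}

theorem harmonicWeight_mem_Icc (hk : 3 ≤ k) {x : Fin d → ℝ} (hx : x ∈ Set.Icc 0 1) :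
    harmonicWeight k x ∈ Set.Icc 0 1 := by
  have hF := fun j => harmonicF_mem_Icc hk ⟨hx.1 j, hx.2 j⟩
  exact ⟨Finset.prod_nonneg fun j _ => (hF j).1,
    Finset.prod_le_one (fun j _ => (hF j).1) fun j _ => (le_min_iff.1 (hF j).2).1⟩

theorem harmonicWeight_eq_baseWeight_mul {ι : Type*} (k : ℕ) (len : ι → Fin (d + 1) → ℝ) (i : ι) :
    harmonicWeight k (len i) = baseWeight k len i * harmonicF k (len i (Fin.last d)) :=
  Fin.prod_univ_castSucc _

end Harmonic

/-! ### Packings -/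

section Packing

variable {ι : Type*} {d : ℕ} {len : ι → Fin d → ℝ} {pos : ι → Fin d → ℝ}

theorem cuboidVol_nonneg {x : Fin d → ℝ} (hx : 0 ≤ x) : 0 ≤ cuboidVol x :=
  Finset.prod_nonneg fun j _ => hx j

theorem IsPacking.sum_cuboidVol_le_one {S : Finset ι} (h : IsPacking len S pos)
    (hlen : ∀ i ∈ S, 0 ≤ len i) : ∑ i ∈ S, cuboidVol (len i) ≤ 1 := by
  have hvol : ∀ i ∈ S, MeasureTheory.volume (Set.Icc (pos i) (pos i + len i)) =
      ENNReal.ofReal (cuboidVol (len i)) := fun i hi => by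
    rw [Real.volume_Icc_pi, cuboidVol, ENNReal.ofReal_prod_of_nonneg fun j _ => hlen i hi j]
    simp
  have hunion : MeasureTheory.volume (⋃ i ∈ S, Set.Icc (pos i) (pos i + len i)) =
      ∑ i ∈ S, MeasureTheory.volume (Set.Icc (pos i) (pos i + len i)) :=
    MeasureTheory.measure_biUnion_finset₀ (fun i hi i' hi' hne => h.2 i hi i' hi' hne)
      fun _ _ => measurableSet_Icc.nullMeasurableSet
  have hcube : MeasureTheory.volume (Set.Icc (0 : Fin d → ℝ) 1) = 1 := by
    simp [Real.volume_Icc_pi]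
  rw [← ENNReal.ofReal_le_one,
    ENNReal.ofReal_sum_of_nonneg fun i hi => cuboidVol_nonneg (hlen i hi),
    ← Finset.sum_congr rfl hvol, ← hunion, ← hcube]
  exact MeasureTheory.measure_mono (Set.iUnion₂_subset h.1)

/-- The items of `I` lie in the unit cube, and any two of them are separated by a hyperplane
orthogonal to a coordinate axis. All packings made by the algorithm have this property, which is
easier to propagate through recursive constructions than a statement about volumes. -/
structure IsAxisSeparated (len : ι → Fin d → ℝ) (I : List ι) (pos : ι → Fin d → ℝ) : Prop where
  nonneg : ∀ i ∈ I, 0 ≤ pos i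
  add_le_one : ∀ i ∈ I, pos i + len i ≤ 1
  separated : ∀ i ∈ I, ∀ i' ∈ I, i ≠ i' →
    ∃ j, pos i j + len i j ≤ pos i' j ∨ pos i' j + len i' j ≤ pos i j

namespace IsAxisSeparated

variable {I I' : List ι}

theorem mono (h : IsAxisSeparated len I pos) (hI : I' ⊆ I) : IsAxisSeparated len I' pos where
  nonneg i hi := h.nonneg i (hI hi)
  add_le_one i hi := h.add_le_one i (hI hi)
  separated i hi i' hi' := h.separated i (hI hi) i' (hI hi')

theorem isPacking [DecidableEq ι] (h : IsAxisSeparated len I pos) :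
    IsPacking len I.toFinset pos := by
  simp only [IsPacking, List.mem_toFinset]
  refine ⟨fun i hi => Set.Icc_subset_Icc (h.nonneg i hi) (h.add_le_one i hi),
    fun i hi i' hi' hne => ?_⟩
  obtain ⟨j, hj⟩ := h.separated i hi i' hi' hne
  rw [Set.Icc_inter_Icc, Real.volume_Icc_pi]
  refine Finset.prod_eq_zero (Finset.mem_univ j) (ENNReal.ofReal_eq_zero.2 (sub_nonpos.2 ?_))
  rcases hj with hj | hj
  · exact (inf_le_left.trans hj).trans le_sup_right
  · exact (inf_le_right.trans hj).trans le_sup_left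

end IsAxisSeparated

theorem baseLen_mem_Icc {m : ℕ} {len : ι → Fin (m + 1) → ℝ} {i : ι}
    (h : len i ∈ Set.Icc 0 1) : baseLen len i ∈ Set.Icc 0 1 :=
  ⟨fun j => h.1 j.castSucc, fun j => h.2 j.castSucc⟩

end Packing

/-! ### Cutting a sequence into groups -/

section Groups

variable {ι : Type*} {w : ι → ℝ}

theorem exists_cutGroups_eq_cons (c : ℝ) {l : List ι} (hl : l ≠ []) :
    ∃ g l', l = g ++ l' ∧ g ≠ [] ∧ cutGroups w c l = g :: cutGroups w 0 l' ∧
      (c < 1 → c + (g.dropLast.map w).sum < 1) ∧ (l' ≠ [] → 1 ≤ c + (g.map w).sum) := by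
  induction l generalizing c with
  | nil => exact absurd rfl hl
  | cons a l ih =>
    by_cases h : 1 ≤ c + w a
    · exact ⟨[a], l, rfl, by simp, by simp [cutGroups, h], by simp, fun _ => by simpa using h⟩
    · rcases eq_or_ne l [] with rfl | hl'
      · exact ⟨[a], [], rfl, by simp, by simp [cutGroups, h], by simp, by simp⟩
      · obtain ⟨g, l', rfl, hg, hcut, hlt, hle⟩ := ih (c + w a) hl'
        refine ⟨a :: g, l', rfl, by simp, by simp [cutGroups, h, hcut], fun _ => ?_, fun hl => ?_⟩
        · rw [List.dropLast_cons_of_ne_nil hg, List.map_cons, List.sum_cons, ← add_assoc]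
          exact hlt (not_le.1 h)
        · rw [List.map_cons, List.sum_cons, ← add_assoc]
          exact hle hl

theorem cutGroups_induction {motive : List ι → List (List ι) → Prop} (nil : motive [] [])
    (cons : ∀ g l, g ≠ [] → (g.dropLast.map w).sum < 1 → (l ≠ [] → 1 ≤ (g.map w).sum) →
      motive l (cutGroups w 0 l) → motive (g ++ l) (g :: cutGroups w 0 l))
    (l : List ι) : motive l (cutGroups w 0 l) := by
  induction hn : l.length using Nat.strong_induction_on generalizing l with
  | _ n ih =>
    rcases eq_or_ne l [] with rfl | hl
    · exact nil
    · obtain ⟨g, l', rfl, hg, hcut, hlt, hle⟩ := exists_cutGroups_eq_cons (w := w) 0 hl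
      have hpos := List.length_pos_iff.2 hg
      rw [List.length_append] at hn
      rw [hcut]
      exact cons g l' hg (by simpa using hlt one_pos) (by simpa using hle)
        (ih l'.length (by omega) l' rfl)

theorem flatten_cutGroups (l : List ι) : (cutGroups w 0 l).flatten = l :=
  cutGroups_induction (motive := fun l gs => gs.flatten = l) rfl
    (fun g l _ _ _ ih => by rw [List.flatten_cons, ih]) l

theorem mem_of_mem_cutGroups {l g : List ι} (hg : g ∈ cutGroups w 0 l) {i : ι} (hi : i ∈ g) :
    i ∈ l := by
  rw [← flatten_cutGroups (w := w) l]
  exact List.mem_flatten.2 ⟨g, hg, hi⟩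

theorem sum_dropLast_lt_one_of_mem_cutGroups {l g : List ι} :
    g ∈ cutGroups w 0 l → (g.dropLast.map w).sum < 1 :=
  cutGroups_induction (motive := fun _ gs => g ∈ gs → (g.dropLast.map w).sum < 1) (by simp)
    (fun _ _ _ hlt _ ih hg => (List.mem_cons.1 hg).elim (fun h => h ▸ hlt) ih) l

theorem cutGroups_eq_map_singleton {l : List ι} (hw : ∀ i ∈ l, 1 ≤ w i) :
    cutGroups w 0 l = l.map fun i => [i] := by
  induction l with
  | nil => rfl
  | cons a l ih =>
    rw [List.forall_mem_cons] at hw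
    simp [cutGroups, hw.1, ih hw.2]

theorem length_cutGroups_le {l : List ι} (hw : ∀ i ∈ l, 0 ≤ w i) {n : ℕ}
    (hn : (l.dropLast.map w).sum < n) : (cutGroups w 0 l).length ≤ n := by
  induction l using cutGroups_induction (w := w) generalizing n with
  | nil => simp
  | cons g l _ _ hle ih =>
    have hnn : 0 ≤ ((g ++ l).dropLast.map w).sum :=
      sum_map_nonneg fun i hi => hw i (List.mem_of_mem_dropLast hi)
    obtain ⟨n, rfl⟩ : ∃ n', n = n' + 1 :=
      Nat.exists_eq_add_one.2 (Nat.cast_pos.1 (hnn.trans_lt hn))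
    rcases eq_or_ne l [] with rfl | hl
    · simp [cutGroups]
    · rw [List.dropLast_append_of_ne_nil hl, List.map_append, List.sum_append] at hn
      push_cast at hn
      have := ih (fun i hi => hw i (List.mem_append_right _ hi)) (n := n) (by linarith [hle hl])
      simpa using this

end Groups

/-! ### Heights of groups -/

section Heights

variable {ι : Type*} {m : ℕ} {len : ι → Fin (m + 1) → ℝ} {w : ι → ℝ} {J l : List ι} {c : ℝ}

theorem maxHeight_le_iff : maxHeight len J ≤ c ↔ 0 ≤ c ∧ ∀ i ∈ J, len i (Fin.last m) ≤ c :=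
  foldr_max_le_iff.trans (and_congr_right fun _ => List.forall_mem_map)

theorem maxHeight_nonneg (J : List ι) : 0 ≤ maxHeight len J := (maxHeight_le_iff.1 le_rfl).1

theorem le_maxHeight : ∀ i ∈ J, len i (Fin.last m) ≤ maxHeight len J :=
  (maxHeight_le_iff.1 le_rfl).2

theorem sortByHeight_perm (l : List ι) : (sortByHeight len l).Perm l := List.mergeSort_perm _ _

theorem ite_sortByHeight_perm (p : Prop) [Decidable p] (l : List ι) :
    (if p then sortByHeight len l else l).Perm l := by
  split_ifs
  exacts [sortByHeight_perm l, .refl l]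

theorem pairwise_sortByHeight (l : List ι) :
    (sortByHeight len l).Pairwise fun a b => len b (Fin.last m) ≤ len a (Fin.last m) := by
  have := List.pairwise_mergeSort
    (le := fun a b : ι => decide (len b (Fin.last m) ≤ len a (Fin.last m)))
    (fun a b c hab hbc => by simp only [decide_eq_true_eq] at *; exact hbc.trans hab)
    (fun a b => by simpa using le_total _ _) l
  simpa [sortByHeight] using this

/-- Every item of a complete group is at least as high as the next group, and the group has weight
at least `1`, so each group pays for the height of its successor. -/
theorem sum_tail_map_maxHeight_cutGroups_le (hw : ∀ i ∈ l, 0 ≤ w i)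
    (hlen : ∀ i ∈ l, 0 ≤ len i (Fin.last m))
    (hsort : l.Pairwise fun a b => len b (Fin.last m) ≤ len a (Fin.last m)) :
    (((cutGroups w 0 l).tail).map (maxHeight len)).sum ≤
      (l.map fun i => w i * len i (Fin.last m)).sum := by
  induction l using cutGroups_induction (w := w) with
  | nil => simp
  | cons g l _ _ hle ih =>
    rw [List.pairwise_append] at hsort
    simp only [List.mem_append, or_imp, forall_and] at hw hlen
    rw [List.tail_cons, List.map_append, List.sum_append]
    rcases eq_or_ne l [] with rfl | hl
    · simpa [cutGroups] using sum_map_nonneg fun i hi => mul_nonneg (hw.1 i hi) (hlen.1 i hi)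
    · have ih := ih hw.2 hlen.2 hsort.2.1
      obtain ⟨g', l', hl', -, hcut, -⟩ := exists_cutGroups_eq_cons (w := w) 0 hl
      rw [hcut, List.tail_cons] at ih
      rw [hcut, List.map_cons, List.sum_cons]
      have hg' : ∀ i ∈ g, maxHeight len g' ≤ len i (Fin.last m) := fun i hi =>
        maxHeight_le_iff.2 ⟨hlen.1 i hi, fun b hb =>
          hsort.2.2 i hi b (hl' ▸ List.mem_append_left _ hb)⟩
      exact add_le_add (le_sum_map_mul_of_one_le_sum hw.1 (maxHeight_nonneg g') hg' (hle hl)) ih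

theorem sum_map_maxHeight_cutGroups_le (hw : ∀ i ∈ l, 0 ≤ w i) (hc : 0 ≤ c)
    (hlen : ∀ i ∈ l, len i (Fin.last m) ∈ Set.Icc 0 c)
    (hsort : l.Pairwise fun a b => len b (Fin.last m) ≤ len a (Fin.last m)) :
    ((cutGroups w 0 l).map (maxHeight len)).sum ≤
      c + (l.map fun i => w i * len i (Fin.last m)).sum := by
  have htail := sum_tail_map_maxHeight_cutGroups_le hw (fun i hi => (hlen i hi).1) hsort
  rcases h : cutGroups w 0 l with - | ⟨g, gs⟩
  · exact add_nonneg hc (sum_map_nonneg fun i hi => mul_nonneg (hw i hi) (hlen i hi).1)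
  · rw [h] at htail
    have hg : maxHeight len g ≤ c := maxHeight_le_iff.2 ⟨hc, fun i hi =>
      (hlen i (mem_of_mem_cutGroups (h ▸ List.mem_cons_self) hi)).2⟩
    exact add_le_add hg htail

end Heights

/-! ### Stacking shelves -/

section Stack

variable {ι : Type*} {m : ℕ} {len : ι → Fin (m + 1) → ℝ}

/-- A shelf that holds its items: their bases are packed, and they are not higher than the shelf. -/
structure HarmonicShelf.IsPacked (len : ι → Fin (m + 1) → ℝ) (S : HarmonicShelf ι m) : Prop where
  base : IsAxisSeparated (baseLen len) S.items S.pos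
  le_height : ∀ i ∈ S.items, len i (Fin.last m) ≤ S.height
  height_nonneg : 0 ≤ S.height

variable [DecidableEq ι] {L : List (HarmonicShelf ι m)} {i i' : ι}

theorem stackPos_cons (y : ℝ) (S : HarmonicShelf ι m) (L : List (HarmonicShelf ι m)) (i : ι) :
    stackPos y (S :: L) i = if i ∈ S.items then Fin.snoc (α := fun _ => ℝ) (S.pos i) y
      else stackPos (y + S.height) L i := rfl

theorem exists_stackPos_eq_snoc (hL : ∀ S ∈ L, 0 ≤ S.height) (y : ℝ)
    (hi : i ∈ L.flatMap HarmonicShelf.items) :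
    ∃ S ∈ L, i ∈ S.items ∧ ∃ z, y ≤ z ∧ z + S.height ≤ y + (L.map HarmonicShelf.height).sum ∧
      stackPos y L i = Fin.snoc (α := fun _ => ℝ) (S.pos i) z := by
  induction L generalizing y with
  | nil => simp at hi
  | cons S L ih =>
    rw [List.forall_mem_cons] at hL
    rw [stackPos_cons, List.map_cons, List.sum_cons]
    by_cases h : i ∈ S.items
    · refine ⟨S, List.mem_cons_self, h, y, le_rfl, ?_, if_pos h⟩
      linarith [sum_map_nonneg hL.2]
    · obtain ⟨S', hS', hiS', z, hyz, hz, hpos⟩ := ih hL.2 (y + S.height) (by simpa [h] using hi)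
      refine ⟨S', List.mem_cons_of_mem _ hS', hiS', z, ?_, ?_, by rw [if_neg h, hpos]⟩
      · linarith [hL.1]
      · linarith

theorem le_stackPos_last (hL : ∀ S ∈ L, 0 ≤ S.height) (y : ℝ)
    (hi : i ∈ L.flatMap HarmonicShelf.items) : y ≤ stackPos y L i (Fin.last m) := by
  obtain ⟨S, -, -, z, hyz, -, hpos⟩ := exists_stackPos_eq_snoc hL y hi
  rwa [hpos, Fin.snoc_last]

theorem stackPos_separated (hL : ∀ S ∈ L, S.IsPacked len) (y : ℝ)
    (hi : i ∈ L.flatMap HarmonicShelf.items) (hi' : i' ∈ L.flatMap HarmonicShelf.items)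
    (hne : i ≠ i') :
    ∃ j, stackPos y L i j + len i j ≤ stackPos y L i' j ∨
      stackPos y L i' j + len i' j ≤ stackPos y L i j := by
  induction L generalizing y with
  | nil => simp at hi
  | cons S L ih =>
    rw [List.forall_mem_cons] at hL
    have habove : ∀ {a b}, a ∈ S.items → b ∈ L.flatMap HarmonicShelf.items →
        y + len a (Fin.last m) ≤ stackPos (y + S.height) L b (Fin.last m) := fun ha hb =>
      (add_le_add_right (hL.1.le_height _ ha) y).trans
        (le_stackPos_last (fun S' hS' => (hL.2 S' hS').height_nonneg) _ hb)
    rw [List.flatMap_cons, List.mem_append] at hi hi'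
    rw [stackPos_cons, stackPos_cons]
    split_ifs with h h' h'
    · obtain ⟨j, hj⟩ := hL.1.base.separated i h i' h' hne
      exact ⟨j.castSucc, by simpa only [Fin.snoc_castSucc, baseLen] using hj⟩
    · exact ⟨Fin.last m, .inl (by simpa only [Fin.snoc_last] using habove h (hi'.resolve_left h'))⟩
    · exact ⟨Fin.last m, .inr (by simpa only [Fin.snoc_last] using habove h' (hi.resolve_left h))⟩
    · exact ih hL.2 _ (hi.resolve_left h) (hi'.resolve_left h')

theorem isAxisSeparated_stackPos (hL : ∀ S ∈ L, S.IsPacked len)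
    (hsum : (L.map HarmonicShelf.height).sum ≤ 1) :
    IsAxisSeparated len (L.flatMap HarmonicShelf.items) (stackPos 0 L) := by
  have hheight : ∀ S ∈ L, 0 ≤ S.height := fun S hS => (hL S hS).height_nonneg
  have hcube : ∀ i ∈ L.flatMap HarmonicShelf.items, ∀ j,
      0 ≤ stackPos 0 L i j ∧ stackPos 0 L i j + len i j ≤ 1 := fun i hi => by
    obtain ⟨S, hS, hiS, z, h0z, hz, hpos⟩ := exists_stackPos_eq_snoc hheight 0 hi
    rw [hpos]
    refine Fin.lastCases ?_ fun j => ?_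
    · rw [Fin.snoc_last]
      exact ⟨h0z, by linarith [(hL S hS).le_height i hiS]⟩
    · rw [Fin.snoc_castSucc]
      exact ⟨(hL S hS).base.nonneg i hiS j, (hL S hS).base.add_le_one i hiS j⟩
  exact ⟨fun i hi j => (hcube i hi j).1, fun i hi j => (hcube i hi j).2,
    fun i hi i' hi' => stackPos_separated hL 0 hi hi'⟩

end Stack

/-! ### Unit-pack -/

section UnitPack

variable {ι : Type*} {k m q : ℕ} {I : List ι}

theorem baseWeight_mem_Icc (hk : 3 ≤ k) {len : ι → Fin (m + 1) → ℝ} {i : ι}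
    (hi : len i ∈ Set.Icc 0 1) : baseWeight k len i ∈ Set.Icc 0 1 :=
  harmonicWeight_mem_Icc hk (baseLen_mem_Icc hi)

theorem sum_heights_le_one_of_type_lt (hk : 3 ≤ k) {len : ι → Fin (m + 1) → ℝ}
    (hlen : ∀ i ∈ I, len i ∈ Set.Icc 0 1) (hq : 0 < q) (hqk : q < k)
    (htype : ∀ i ∈ I, harmonicType k (len i (Fin.last m)) = q)
    (hI : (I.dropLast.map fun i => harmonicWeight k (len i)).sum < 1) :
    ((cutGroups (baseWeight k len) 0 I).map (maxHeight len)).sum ≤ 1 := by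
  have hq0 : (0 : ℝ) < q := Nat.cast_pos.2 hq
  have hweight : ∀ i ∈ I.dropLast, harmonicWeight k (len i) = baseWeight k len i * (1 / q) := by
    intro i hi
    have hti := htype i (List.mem_of_mem_dropLast hi)
    rw [harmonicWeight_eq_baseWeight_mul, harmonicF_of_lt, hti]
    exact (harmonicType_lt_iff (by omega)).1 (hti ▸ hqk)
  rw [List.map_congr_left hweight, List.sum_map_mul_right, mul_one_div, div_lt_one hq0] at hI
  have hcount := length_cutGroups_le (fun i hi => (baseWeight_mem_Icc hk (hlen i hi)).1) hI
  have hheight : ∀ g ∈ cutGroups (baseWeight k len) 0 I, maxHeight len g ≤ 1 / q :=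
    fun g hg => maxHeight_le_iff.2 ⟨by positivity, fun i hi => by
      have hiI := mem_of_mem_cutGroups hg hi
      exact htype i hiI ▸ le_one_div_harmonicType ((hlen i hiI).2 _)⟩
  calc ((cutGroups (baseWeight k len) 0 I).map (maxHeight len)).sum
      ≤ (cutGroups (baseWeight k len) 0 I).length * (1 / q) := sum_map_le_length_mul hheight
    _ ≤ q * (1 / q) := by gcongr
    _ = 1 := mul_one_div_cancel hq0.ne'

/-- The bound is `1/k + ((k-2)/k + 1/k)`: the first shelf, the items but the last by the factor
`k/(k-2)` in `f_k`, and the last item. -/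
theorem sum_heights_le_one_of_type_eq (hk : 3 ≤ k) {len : ι → Fin (m + 1) → ℝ}
    (hlen : ∀ i ∈ I, len i ∈ Set.Icc 0 1)
    (htype : ∀ i ∈ I, harmonicType k (len i (Fin.last m)) = k)
    (hI : (I.dropLast.map fun i => harmonicWeight k (len i)).sum < 1) :
    ((cutGroups (baseWeight k len) 0 (sortByHeight len I)).map (maxHeight len)).sum ≤ 1 := by
  have hk3 : (3 : ℝ) ≤ k := by exact_mod_cast hk
  have hk2 : (0 : ℝ) < k - 2 := by linarith
  have hsmall : ∀ i ∈ I, len i (Fin.last m) ≤ 1 / k := fun i hi =>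
    htype i hi ▸ le_one_div_harmonicType ((hlen i hi).2 _)
  have hw := fun i hi => baseWeight_mem_Icc hk (hlen i hi)
  have hweight : ∀ i ∈ I.dropLast, baseWeight k len i * len i (Fin.last m) =
      harmonicWeight k (len i) * ((k - 2) / k) := by
    intro i hi
    rw [harmonicWeight_eq_baseWeight_mul,
      harmonicF_of_le (hsmall i (List.mem_of_mem_dropLast hi))]
    field_simp
  have hdrop : (I.dropLast.map fun i => baseWeight k len i * len i (Fin.last m)).sum ≤
      (k - 2) / k := by
    rw [List.map_congr_left hweight, List.sum_map_mul_right]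
    exact mul_le_of_le_one_left (by positivity) hI.le
  have hvol : (I.map fun i => baseWeight k len i * len i (Fin.last m)).sum ≤
      (k - 2) / k + 1 / k :=
    sum_map_le_add_of_sum_dropLast_le (by positivity) (fun i hi =>
      (mul_le_of_le_one_left ((hlen i hi).1 _) (hw i hi).2).trans (hsmall i hi)) hdrop
  have hperm := sortByHeight_perm (len := len) I
  have hbound := sum_map_maxHeight_cutGroups_le (w := baseWeight k len) (c := 1 / k)
    (fun i hi => (hw i (hperm.mem_iff.1 hi)).1) (by positivity)
    (fun i hi => ⟨(hlen i (hperm.mem_iff.1 hi)).1 _, hsmall i (hperm.mem_iff.1 hi)⟩)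
    (pairwise_sortByHeight I)
  rw [(hperm.map _).sum_eq] at hbound
  calc _ ≤ 1 / (k : ℝ) + ((k - 2) / k + 1 / k) := hbound.trans (by gcongr)
    _ = 1 := by field_simp; ring

theorem sum_unitPack_heights_le_one (hk : 3 ≤ k) {len : ι → Fin (m + 1) → ℝ}
    (hlen : ∀ i ∈ I, len i ∈ Set.Icc 0 1)
    (htype : ∀ i ∈ I, harmonicType k (len i (Fin.last m)) = q)
    (hI : (I.dropLast.map fun i => harmonicWeight k (len i)).sum < 1) :
    ((cutGroups (baseWeight k len) 0 (if q = k then sortByHeight len I else I)).map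
      (maxHeight len)).sum ≤ 1 := by
  have hk0 : 0 < k := by omega
  rcases I.eq_nil_or_concat with rfl | ⟨l, a, rfl⟩
  · simp [sortByHeight, cutGroups]
  have ha := htype a (by simp)
  split_ifs with hqk
  · exact sum_heights_le_one_of_type_eq hk hlen (hqk ▸ htype) hI
  · exact sum_heights_le_one_of_type_lt hk hlen (ha ▸ harmonicType_pos hk0 ((hlen a (by simp)).2 _))
      (lt_of_le_of_ne (ha ▸ harmonicType_le hk0) hqk) htype hI

/-- In dimension one all base weights are `1` (empty products), so every item forms a shelf. -/
theorem sum_len_le_one (hk : 3 ≤ k) {len : ι → Fin 1 → ℝ} (hlen : ∀ i ∈ I, len i ∈ Set.Icc 0 1)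
    (htype : ∀ i ∈ I, harmonicType k (len i 0) = q)
    (hI : (I.dropLast.map fun i => harmonicWeight k (len i)).sum < 1) :
    (I.map fun i => len i 0).sum ≤ 1 := by
  have hheights := sum_unitPack_heights_le_one hk hlen htype hI
  rw [cutGroups_eq_map_singleton fun i _ => by simp [baseWeight, cuboidVol], List.map_map,
    ((ite_sortByHeight_perm _ I).map _).sum_eq] at hheights
  exact (List.sum_le_sum fun i _ => le_maxHeight i (List.mem_singleton_self i)).trans hheights

variable [DecidableEq ι]

theorem takeWhile_ne_append_cons {i : ι} {s : List ι} (hi : i ∉ s) (t : List ι) :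
    ((s ++ i :: t).takeWhile fun a => decide (a ≠ i)) = s := by
  rw [List.takeWhile_append_of_pos fun a ha => by simpa using ne_of_mem_of_not_mem ha hi,
    List.takeWhile_cons_of_neg (by simp), List.append_nil]

theorem sum_takeWhile_ne_mem_Icc {x : ι → ℝ} (hx : ∀ i ∈ I, 0 ≤ x i) {i : ι} (hi : i ∈ I) :
    ((I.takeWhile fun a => decide (a ≠ i)).map x).sum ∈ Set.Icc 0 ((I.map x).sum - x i) := by
  obtain ⟨s, t, rfl, his⟩ := List.eq_append_cons_of_mem hi
  simp only [List.mem_append, List.mem_cons, or_imp, forall_and] at hx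
  have hs := sum_map_nonneg hx.1
  have ht := sum_map_nonneg hx.2.2
  rw [takeWhile_ne_append_cons his]
  simp only [List.map_append, List.map_cons, List.sum_append, List.sum_cons]
  exact ⟨hs, by linarith⟩

theorem sum_takeWhile_ne_separated {x : ι → ℝ} (hx : ∀ i ∈ I, 0 ≤ x i) {i i' : ι} (hi : i ∈ I)
    (hi' : i' ∈ I) (hne : i ≠ i') :
    ((I.takeWhile fun a => decide (a ≠ i)).map x).sum + x i ≤
        ((I.takeWhile fun a => decide (a ≠ i')).map x).sum ∨
      ((I.takeWhile fun a => decide (a ≠ i')).map x).sum + x i' ≤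
        ((I.takeWhile fun a => decide (a ≠ i)).map x).sum := by
  obtain ⟨s, t, rfl, his⟩ := List.eq_append_cons_of_mem hi
  simp only [List.mem_append, List.mem_cons, or_imp, forall_and] at hx
  rw [takeWhile_ne_append_cons his]
  by_cases hi's : i' ∈ s
  · right
    obtain ⟨u, v, rfl, hi'u⟩ := List.eq_append_cons_of_mem hi's
    have hu := (sum_takeWhile_ne_mem_Icc hx.1 hi's).2
    rw [takeWhile_ne_append_cons hi'u] at hu
    rw [List.append_assoc, List.cons_append, takeWhile_ne_append_cons hi'u]
    linarith
  · left
    rw [List.takeWhile_append_of_pos fun a ha => by simpa using ne_of_mem_of_not_mem ha hi's,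
      List.takeWhile_cons_of_pos (by simpa using hne)]
    simp only [List.map_append, List.map_cons, List.sum_append, List.sum_cons]
    have hi't : i' ∈ t := by simpa [hi's, hne.symm] using hi'
    linarith [(sum_takeWhile_ne_mem_Icc hx.2.2 hi't).1]

/-- The shelf that holds the items of `J`, with their bases packed by unit-pack as items of
type `t`. -/
def packShelf (k : ℕ) (len : ι → Fin (m + 2) → ℝ) (t : Fin (m + 1) → ℕ) (J : List ι) :
    HarmonicShelf ι (m + 1) where
  items := J
  height := maxHeight len J
  pos := hdhUnitPack k m (baseLen len) t J

theorem hdhUnitPack_succ (len : ι → Fin (m + 2) → ℝ) (t : Fin (m + 2) → ℕ) (I : List ι) :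
    hdhUnitPack k (m + 1) len t I =
      stackPos 0 ((cutGroups (baseWeight k len) 0
        (if t (Fin.last (m + 1)) = k then sortByHeight len I else I)).map
          (packShelf k len (Fin.init t))) := rfl

theorem flatMap_items_map_packShelf (len : ι → Fin (m + 2) → ℝ) (t : Fin (m + 1) → ℕ)
    (gs : List (List ι)) :
    (gs.map (packShelf k len t)).flatMap HarmonicShelf.items = gs.flatten := by
  rw [List.flatMap_map]
  exact List.flatMap_id'

theorem isAxisSeparated_hdhUnitPack (hk : 3 ≤ k) {len : ι → Fin (m + 1) → ℝ}
    {t : Fin (m + 1) → ℕ} (hlen : ∀ i ∈ I, len i ∈ Set.Icc 0 1)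
    (htype : ∀ i ∈ I, ∀ j, harmonicType k (len i j) = t j)
    (hI : (I.dropLast.map fun i => harmonicWeight k (len i)).sum < 1) :
    IsAxisSeparated len I (hdhUnitPack k m len t I) := by
  induction m generalizing I with
  | zero =>
    have hnn : ∀ i ∈ I, 0 ≤ len i 0 := fun i hi => (hlen i hi).1 0
    have hsum := sum_len_le_one hk hlen (fun i hi => htype i hi 0) hI
    refine ⟨fun i hi _ => (sum_takeWhile_ne_mem_Icc hnn hi).1, fun i hi => ?_,
      fun i hi i' hi' hne => ⟨0, sum_takeWhile_ne_separated hnn hi hi' hne⟩⟩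
    refine Fin.forall_fin_one.2 ?_
    have := (sum_takeWhile_ne_mem_Icc hnn hi).2
    exact (le_sub_iff_add_le.1 this).trans hsum
  | succ m ih =>
    have hperm := ite_sortByHeight_perm (len := len) (t (Fin.last (m + 1)) = k) I
    have hsum := sum_unitPack_heights_le_one hk hlen (fun i hi => htype i hi (Fin.last _)) hI
    rw [hdhUnitPack_succ]
    refine (isAxisSeparated_stackPos (fun S hS => ?_) ?_).mono (I' := I) fun i hi => ?_
    · obtain ⟨J, hJ, rfl⟩ := List.mem_map.1 hS
      have hJI : ∀ i ∈ J, i ∈ I := fun i hi => hperm.mem_iff.1 (mem_of_mem_cutGroups hJ hi)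
      exact ⟨ih (fun i hi => baseLen_mem_Icc (hlen i (hJI i hi)))
        (fun i hi j => htype i (hJI i hi) j.castSucc) (sum_dropLast_lt_one_of_mem_cutGroups hJ),
        le_maxHeight, maxHeight_nonneg J⟩
    · rwa [List.map_map]
    · rw [flatMap_items_map_packShelf, flatten_cutGroups]
      exact hperm.mem_iff.2 hi

end UnitPack

/-! ### Next-Fit -/

section NextFit

variable {ι : Type*} {m : ℕ} {B L : List (HarmonicShelf ι m)} {Ls : List (List (HarmonicShelf ι m))}

theorem flatten_nextFitFrom (B L : List (HarmonicShelf ι m)) :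
    (nextFitFrom B L).flatten = B ++ L := by
  induction L generalizing B with
  | nil => simp [nextFitFrom]
  | cons S L ih => rw [nextFitFrom]; split_ifs <;> simp [ih]

theorem flatten_nextFit (L : List (HarmonicShelf ι m)) : (nextFit L).flatten = L := by
  cases L with
  | nil => rfl
  | cons S L => exact flatten_nextFitFrom [S] L

theorem sum_height_le_one_of_mem_nextFitFrom (hB : (B.map HarmonicShelf.height).sum ≤ 1)
    (hL : ∀ S ∈ L, S.height ≤ 1) :
    ∀ C ∈ nextFitFrom B L, (C.map HarmonicShelf.height).sum ≤ 1 := by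
  induction L generalizing B with
  | nil => simpa [nextFitFrom] using hB
  | cons S L ih =>
    rw [List.forall_mem_cons] at hL
    rw [nextFitFrom]
    split_ifs with hfit
    · exact ih (by simpa using hfit) hL.2
    · exact List.forall_mem_cons.2 ⟨hB, ih (by simpa using hL.1) hL.2⟩

theorem sum_height_le_one_of_mem_nextFit (hL : ∀ S ∈ L, S.height ≤ 1) :
    ∀ C ∈ nextFit L, (C.map HarmonicShelf.height).sum ≤ 1 := by
  cases L with
  | nil => simp [nextFit]
  | cons S L =>
    rw [List.forall_mem_cons] at hL
    exact sum_height_le_one_of_mem_nextFitFrom (by simpa using hL.1) hL.2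

/-- The contents of a closed bin and the shelf that opens the next one have total height more than
`1`. A shelf counts twice because it can be used on both sides of this estimate. -/
theorem length_nextFitFrom_le (hL : ∀ S ∈ L, 0 ≤ S.height) {n : ℕ} (hn : 0 < n)
    (hsum : (B.map HarmonicShelf.height).sum + 2 * (L.map HarmonicShelf.height).sum ≤ n) :
    (nextFitFrom B L).length ≤ n := by
  induction L generalizing B n with
  | nil => simpa [nextFitFrom, Nat.one_le_iff_ne_zero] using hn.ne'
  | cons S L ih =>
    rw [List.forall_mem_cons] at hL
    rw [List.map_cons, List.sum_cons] at hsum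
    rw [nextFitFrom]
    split_ifs with hfit
    · refine ih hL.2 hn ?_
      rw [List.map_append, List.sum_append, List.map_singleton, List.sum_singleton]
      linarith [hL.1]
    · have hLnn := sum_map_nonneg hL.2
      obtain ⟨n, rfl⟩ := Nat.exists_eq_add_one.2 hn
      push_cast at hsum
      have hn' : 0 < n := Nat.cast_pos.1 (show (0 : ℝ) < n by linarith [hL.1])
      refine Nat.succ_le_succ (ih hL.2 hn' ?_)
      rw [List.map_singleton, List.sum_singleton]
      linarith

theorem length_nextFit_le (hL : ∀ S ∈ L, 0 ≤ S.height) {n : ℕ} (hn : 0 < n)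
    (hsum : 2 * (L.map HarmonicShelf.height).sum ≤ n) : (nextFit L).length ≤ n := by
  cases L with
  | nil => simp [nextFit]
  | cons S L =>
    rw [List.forall_mem_cons] at hL
    rw [List.map_cons, List.sum_cons] at hsum
    refine length_nextFitFrom_le hL.2 hn ?_
    rw [List.map_singleton, List.sum_singleton]
    linarith [hL.1]

/-- The distribution of lists of shelves into bins made by HDH-NF: the first shelf of each list
gets a bin of its own, and Next-Fit packs all other shelves. -/
def binShelves (Ls : List (List (HarmonicShelf ι m))) : List (List (HarmonicShelf ι m)) :=
  ((Ls.filterMap List.head?).map fun S => [S]) ++ nextFit (Ls.flatMap List.tail)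

theorem flatten_binShelves_perm (Ls : List (List (HarmonicShelf ι m))) :
    (binShelves Ls).flatten.Perm Ls.flatten := by
  rw [binShelves, List.flatten_append, flatten_nextFit, ← List.flatMap_def,
    List.flatMap_singleton']
  exact filterMap_head?_append_flatMap_tail_perm Ls

theorem mem_flatten_of_mem_flatMap_tail {S : HarmonicShelf ι m} (hS : S ∈ Ls.flatMap List.tail) :
    S ∈ Ls.flatten :=
  (filterMap_head?_append_flatMap_tail_perm Ls).subset (List.mem_append_right _ hS)

theorem sum_height_le_one_of_mem_binShelves (hLs : ∀ S ∈ Ls.flatten, S.height ≤ 1)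
    (hB : B ∈ binShelves Ls) : (B.map HarmonicShelf.height).sum ≤ 1 := by
  rcases List.mem_append.1 hB with h | h
  · obtain ⟨S, -, rfl⟩ := List.mem_map.1 h
    have hS : S ∈ (binShelves Ls).flatten := List.mem_flatten.2 ⟨[S], hB, by simp⟩
    simpa using hLs S ((flatten_binShelves_perm Ls).subset hS)
  · exact sum_height_le_one_of_mem_nextFit
      (fun S hS => hLs S (mem_flatten_of_mem_flatMap_tail hS)) B h

theorem length_binShelves_le (hLs : ∀ S ∈ Ls.flatten, 0 ≤ S.height) {n : ℕ} (hn : 0 < n)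
    (hsum : 2 * ((Ls.flatMap List.tail).map HarmonicShelf.height).sum ≤ n) :
    (binShelves Ls).length ≤ Ls.length + n := by
  rw [binShelves, List.length_append, List.length_map]
  exact add_le_add (List.length_filterMap_le _ _)
    (length_nextFit_le (fun S hS => hLs S (mem_flatten_of_mem_flatMap_tail hS)) hn hsum)

end NextFit

/-! ### HDH-NF -/

section HdhNF

variable {ι : Type*} {k m : ℕ} {len : ι → Fin (m + 2) → ℝ} {I : List ι}

theorem flatMap_filter_baseType_perm (k : ℕ) (len : ι → Fin (m + 2) → ℝ) (I : List ι) :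
    ((I.map (baseType k len)).dedup.flatMap fun t =>
      I.filter fun i => decide (baseType k len i = t)).Perm I :=
  flatMap_filter_eq_perm _ (List.nodup_dedup _) fun _ hi =>
    List.mem_dedup.2 (List.mem_map_of_mem hi)

variable [DecidableEq ι]

/-- The lists of shelves that HDH-NF makes, one for each base type that occurs in `I`. -/
def hdhShelfLists (k : ℕ) (len : ι → Fin (m + 2) → ℝ) (I : List ι) :
    List (List (HarmonicShelf ι (m + 1))) :=
  (I.map (baseType k len)).dedup.map (hdhShelves k len I)

theorem hdhNF_eq_map_stackBin (k : ℕ) (len : ι → Fin (m + 2) → ℝ) (I : List ι) :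
    hdhNF k len I = (binShelves (hdhShelfLists k len I)).map stackBin := rfl

theorem hdhShelves_eq_map_packShelf (k : ℕ) (len : ι → Fin (m + 2) → ℝ) (I : List ι)
    (t : Fin (m + 1) → ℕ) :
    hdhShelves k len I t = (cutGroups (baseWeight k len) 0
      (sortByHeight len (I.filter fun i => decide (baseType k len i = t)))).map
        (packShelf k len t) := rfl

theorem flatMap_items_hdhShelves_perm (k : ℕ) (len : ι → Fin (m + 2) → ℝ) (I : List ι)
    (t : Fin (m + 1) → ℕ) :
    ((hdhShelves k len I t).flatMap HarmonicShelf.items).Perm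
      (I.filter fun i => decide (baseType k len i = t)) := by
  rw [hdhShelves_eq_map_packShelf, flatMap_items_map_packShelf, flatten_cutGroups]
  exact sortByHeight_perm _

theorem flatMap_items_binShelves_perm (k : ℕ) (len : ι → Fin (m + 2) → ℝ) (I : List ι) :
    ((binShelves (hdhShelfLists k len I)).flatMap fun B =>
      B.flatMap HarmonicShelf.items).Perm I := by
  rw [← List.flatMap_assoc, List.flatMap_id']
  refine ((flatten_binShelves_perm _).flatMap_right _).trans ?_
  rw [hdhShelfLists, ← List.flatMap_def, List.flatMap_assoc]
  exact (List.Perm.flatMap_left _ fun t _ => flatMap_items_hdhShelves_perm k len I t).trans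
    (flatMap_filter_baseType_perm k len I)

theorem isPacked_of_mem_hdhShelves (hk : 3 ≤ k) (hlen : ∀ i ∈ I, len i ∈ Set.Icc 0 1)
    {t : Fin (m + 1) → ℕ} {S : HarmonicShelf ι (m + 1)} (hS : S ∈ hdhShelves k len I t) :
    S.IsPacked len ∧ S.height ≤ 1 := by
  obtain ⟨J, hJ, rfl⟩ := List.mem_map.1 hS
  have hmem : ∀ i ∈ J, i ∈ I ∧ baseType k len i = t := fun i hi => by
    simpa using (sortByHeight_perm _).mem_iff.1 (mem_of_mem_cutGroups hJ hi)
  have hbase : IsAxisSeparated (baseLen len) J (hdhUnitPack k m (baseLen len) t J) :=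
    isAxisSeparated_hdhUnitPack hk (fun i hi => baseLen_mem_Icc (hlen i (hmem i hi).1))
      (fun i hi j => congrFun (hmem i hi).2 j) (sum_dropLast_lt_one_of_mem_cutGroups hJ)
  exact ⟨⟨hbase, le_maxHeight, maxHeight_nonneg J⟩,
    maxHeight_le_iff.2 ⟨zero_le_one, fun i hi => (hlen i (hmem i hi).1).2 _⟩⟩

theorem isPacked_of_mem_hdhShelfLists (hk : 3 ≤ k) (hlen : ∀ i ∈ I, len i ∈ Set.Icc 0 1)
    {S : HarmonicShelf ι (m + 1)} (hS : S ∈ (hdhShelfLists k len I).flatten) :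
    S.IsPacked len ∧ S.height ≤ 1 := by
  rw [hdhShelfLists, ← List.flatMap_def] at hS
  obtain ⟨t, -, ht⟩ := List.mem_flatMap.1 hS
  exact isPacked_of_mem_hdhShelves hk hlen ht

theorem sum_height_tail_hdhShelves_le (hk : 3 ≤ k) (hlen : ∀ i ∈ I, len i ∈ Set.Icc 0 1)
    (t : Fin (m + 1) → ℕ) :
    ((hdhShelves k len I t).tail.map HarmonicShelf.height).sum ≤
      ((I.filter fun i => decide (baseType k len i = t)).map fun i =>
        baseWeight k len i * len i (Fin.last _)).sum := by
  have hperm := sortByHeight_perm (len := len) (I.filter fun i => decide (baseType k len i = t))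
  have hsub := fun i hi => hlen i (List.mem_of_mem_filter (hperm.mem_iff.1 hi))
  rw [← (hperm.map _).sum_eq, hdhShelves_eq_map_packShelf, ← List.map_tail, List.map_map]
  exact sum_tail_map_maxHeight_cutGroups_le (fun i hi => (baseWeight_mem_Icc hk (hsub i hi)).1)
    (fun i hi => (hsub i hi).1 _) (pairwise_sortByHeight _)

theorem sum_height_flatMap_tail_hdhShelfLists_le (hk : 3 ≤ k)
    (hlen : ∀ i ∈ I, len i ∈ Set.Icc 0 1) :
    (((hdhShelfLists k len I).flatMap List.tail).map HarmonicShelf.height).sum ≤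
      (I.map fun i => baseWeight k len i * len i (Fin.last _)).sum := by
  rw [← ((flatMap_filter_baseType_perm k len I).map _).sum_eq, hdhShelfLists, List.flatMap_map,
    List.map_flatMap, List.map_flatMap, List.flatMap_def, List.flatMap_def, List.sum_flatten,
    List.sum_flatten, List.map_map, List.map_map]
  exact List.sum_le_sum fun t _ => sum_height_tail_hdhShelves_le hk hlen t

theorem length_hdhShelfLists_le (hk : 3 ≤ k) (hlen : ∀ i ∈ I, len i ∈ Set.Icc 0 1) :
    (hdhShelfLists k len I).length ≤ k ^ (m + 1) := by
  rw [hdhShelfLists, List.length_map, ← List.card_toFinset]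
  calc (I.map (baseType k len)).toFinset.card
      ≤ (Fintype.piFinset fun _ : Fin (m + 1) => Finset.Icc 1 k).card := by
        refine Finset.card_le_card fun t ht => ?_
        obtain ⟨i, hi, rfl⟩ := List.mem_map.1 (List.mem_toFinset.1 ht)
        exact Fintype.mem_piFinset.2 fun j => Finset.mem_Icc.2
          ⟨harmonicType_pos (by omega) ((hlen i hi).2 _), harmonicType_le (by omega)⟩
    _ = k ^ (m + 1) := by simp [Fintype.card_piFinset]

theorem isBinPacking_hdhNF (hk : 3 ≤ k) (hlen : ∀ i ∈ I, len i ∈ Set.Icc 0 1) (hI : I.Nodup) :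
    IsBinPacking len I.toFinset (hdhNF k len I) := by
  have hperm := flatMap_items_binShelves_perm k len I
  rw [hdhNF_eq_map_stackBin]
  refine ⟨List.forall_mem_map.2 fun B hB => ?_, List.pairwise_map.2 ?_, fun i => ?_⟩
  · have hpacked : ∀ S ∈ B, S.IsPacked len := fun S hS =>
      (isPacked_of_mem_hdhShelfLists hk hlen
        ((flatten_binShelves_perm _).subset (List.mem_flatten.2 ⟨B, hB, hS⟩))).1
    exact (isAxisSeparated_stackPos hpacked (sum_height_le_one_of_mem_binShelves
      (fun S hS => (isPacked_of_mem_hdhShelfLists hk hlen hS).2) hB)).isPacking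
  · exact (List.nodup_flatMap.1 (hperm.nodup_iff.2 hI)).2.imp fun h =>
      List.disjoint_toFinset_iff_disjoint.2 h
  · rw [List.mem_toFinset, ← hperm.mem_iff, List.mem_flatMap]
    simp [stackBin]

theorem length_hdhNF_le (hk : 3 ≤ k) (hlen : ∀ i ∈ I, len i ∈ Set.Icc 0 1) {n : ℕ} (hn : 0 < n)
    (hsum : 2 * (I.map fun i => baseWeight k len i * len i (Fin.last _)).sum ≤ n) :
    (hdhNF k len I).length ≤ k ^ (m + 1) + n := by
  rw [hdhNF_eq_map_stackBin, List.length_map]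
  refine (length_binShelves_le (fun S hS =>
    (isPacked_of_mem_hdhShelfLists hk hlen hS).1.height_nonneg) hn ?_).trans
    (Nat.add_le_add_right (length_hdhShelfLists_le hk hlen) n)
  linarith [sum_height_flatMap_tail_hdhShelfLists_le hk hlen]

end HdhNF

/-! ### Choices from itemsets -/

section Choice

variable {ι : Type*} [DecidableEq ι] {itemsets : Finset (Finset ι)} {S I : Finset ι} {i : ι}

theorem isChoice_empty : IsChoice itemsets ∅ := ⟨Finset.empty_subset _, by simp⟩

namespace IsChoice

theorem exists_mem (h : IsChoice itemsets S) (hi : i ∈ S) : ∃ I ∈ itemsets, i ∈ I :=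
  Finset.mem_biUnion.1 (h.1 hi)

theorem mono {S' : Finset ι} (h : IsChoice itemsets S) (hS : S' ⊆ S) : IsChoice itemsets S' :=
  ⟨hS.trans h.1, fun I hI =>
    (Finset.card_le_card (Finset.inter_subset_inter_right hS)).trans (h.2 I hI)⟩

theorem card_le (h : IsChoice itemsets S) : S.card ≤ itemsets.card :=
  calc S.card = (itemsets.biUnion fun I => S ∩ I).card := by
        rw [← Finset.inter_biUnion]
        exact congrArg Finset.card (Finset.inter_eq_left.2 h.1).symm
    _ ≤ itemsets.card * 1 := Finset.card_biUnion_le_card_mul _ _ 1 h.2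
    _ = itemsets.card := mul_one _

theorem insert (h : IsChoice itemsets S)
    (hdis : ∀ I ∈ itemsets, ∀ I' ∈ itemsets, I ≠ I' → Disjoint I I')
    (hI : I ∈ itemsets) (hi : i ∈ I) (hS : Disjoint S I) : IsChoice itemsets (insert i S) := by
  refine ⟨Finset.insert_subset (Finset.mem_biUnion.2 ⟨I, hI, hi⟩) h.1, fun I' hI' => ?_⟩
  rcases eq_or_ne I I' with rfl | hne
  · rw [Finset.insert_inter_of_mem hi, Finset.disjoint_iff_inter_eq_empty.1 hS]
    exact (Finset.card_singleton i).le
  · rw [Finset.insert_inter_of_notMem (Finset.disjoint_left.1 (hdis I hI I' hI' hne) hi)]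
    exact h.2 I' hI'

theorem sdiff_eq_or_exists_eq_insert_sdiff (h : IsChoice itemsets S) (hI : I ∈ itemsets) :
    S \ I = S ∨ ∃ i ∈ I, S = Insert.insert i (S \ I) := by
  rcases Nat.le_one_iff_eq_zero_or_eq_one.1 (h.2 I hI) with h0 | h1
  · exact Or.inl (Finset.sdiff_eq_self_iff_disjoint.2
      (Finset.disjoint_iff_inter_eq_empty.2 (Finset.card_eq_zero.1 h0)))
  · obtain ⟨i, hi⟩ := Finset.card_eq_one.1 h1
    have hiI : i ∈ S ∩ I := hi ▸ Finset.mem_singleton_self i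
    refine Or.inr ⟨i, Finset.mem_of_mem_inter_right hiI, ?_⟩
    rw [Finset.insert_eq, ← hi, Finset.union_comm, Finset.sdiff_union_inter]

end IsChoice

end Choice

/-! ### Lawler's approximation scheme -/

theorem mul_floor_div_le {K x : ℝ} (hK : 0 ≤ K) (hx : 0 ≤ x) : K * ⌊x / K⌋₊ ≤ x := by
  rcases hK.eq_or_lt with rfl | hK
  · simpa using hx
  · rw [mul_comm, ← le_div_iff₀ hK]
    exact Nat.floor_le (div_nonneg hx hK.le)

theorem le_mul_floor_div_add_one {K : ℝ} (hK : 0 < K) (x : ℝ) : x ≤ K * (⌊x / K⌋₊ + 1) := by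
  rw [mul_comm, ← div_le_iff₀ hK]
  exact (Nat.lt_floor_add_one _).le

namespace MCKS1

variable {ι : Type*}

/-- The standing assumptions on a one-dimensional instance, parallel to `MCKS.IsValid`: different
itemsets share no item, every item fits into the knapsack, sizes and profits are nonnegative. -/
structure IsValid (P : MCKS1 ι) : Prop where
  disjoint : ∀ I ∈ P.itemsets, ∀ I' ∈ P.itemsets, I ≠ I' → Disjoint I I'
  size_nonneg : ∀ I ∈ P.itemsets, ∀ i ∈ I, 0 ≤ P.size i
  size_le_one : ∀ I ∈ P.itemsets, ∀ i ∈ I, P.size i ≤ 1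
  profit_nonneg : ∀ I ∈ P.itemsets, ∀ i ∈ I, 0 ≤ P.profit i

variable {P : MCKS1 ι} {ε : ℝ} {S S' T I : Finset ι} {L C : List (Finset ι)} {i : ι}

theorem mem_allItems {c : Finset ι × ι} : c ∈ P.allItems ↔ c.1 ∈ P.itemsets ∧ c.2 ∈ c.1 := by
  obtain ⟨I, i⟩ := c
  simp only [allItems, List.mem_flatMap, Finset.mem_toList, List.mem_map, Prod.mk.injEq]
  exact ⟨by rintro ⟨_, hI, _, hi, rfl, rfl⟩; exact ⟨hI, hi⟩,
    fun ⟨hI, hi⟩ => ⟨I, hI, i, hi, rfl, rfl⟩⟩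

variable [DecidableEq ι]

namespace IsValid

theorem profit_nonneg_of_isChoice (hP : P.IsValid) (hS : IsChoice P.itemsets S) (hi : i ∈ S) :
    0 ≤ P.profit i := by
  obtain ⟨I, hI, hiI⟩ := hS.exists_mem hi
  exact hP.profit_nonneg I hI i hiI

theorem isFeasible_mono (hP : P.IsValid) (hS : P.IsFeasible S) (h : S' ⊆ S) :
    P.IsFeasible S' := by
  refine ⟨hS.1.mono h, (Finset.sum_le_sum_of_subset_of_nonneg h fun i hi _ => ?_).trans hS.2⟩
  obtain ⟨I, hI, hiI⟩ := hS.1.exists_mem hi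
  exact hP.size_nonneg I hI i hiI

end IsValid

theorem isFeasible_empty : P.IsFeasible ∅ := ⟨isChoice_empty, by simp [totalSize]⟩

namespace IsValid

theorem isFeasible_singleton (hP : P.IsValid) (hI : I ∈ P.itemsets) (hi : i ∈ I) :
    P.IsFeasible {i} :=
  ⟨isChoice_empty.insert hP.disjoint hI hi (Finset.disjoint_empty_left I),
    by simpa [totalSize] using hP.size_le_one I hI i hi⟩

theorem isFeasible_greedy (hP : P.IsValid) (t : ℕ) (hS : P.IsFeasible S) :
    P.IsFeasible (P.greedy t S) := by
  induction t generalizing S with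
  | zero => exact hS
  | succ t ih =>
    rw [greedy]
    split
    · exact hS
    · rename_i c hc
      split_ifs with hle
      · obtain ⟨hI, hi⟩ := mem_allItems.1 (List.mem_of_mem_filter (List.argmax_mem hc))
        exact ih ⟨(hS.1.mono Finset.sdiff_subset).insert hP.disjoint hI hi
          Finset.sdiff_disjoint, hle⟩
      · exact hS

end IsValid

theorem lowerBound_nonneg : 0 ≤ P.lowerBound := le_max_of_le_left (foldr_max_le_iff.1 le_rfl).1

theorem profit_le_lowerBound (hI : I ∈ P.itemsets) (hi : i ∈ I) : P.profit i ≤ P.lowerBound :=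
  le_max_of_le_left ((foldr_max_le_iff.1 le_rfl).2 _
    (List.mem_map.2 ⟨(I, i), mem_allItems.2 ⟨hI, hi⟩, rfl⟩))

theorem IsValid.lowerBound_le (hP : P.IsValid) {c : ℝ}
    (hc : ∀ S, P.IsFeasible S → P.totalProfit S ≤ c) : P.lowerBound ≤ c := by
  refine max_le (foldr_max_le_iff.2 ⟨?_, List.forall_mem_map.2 fun c' hc' => ?_⟩)
    (hc _ (hP.isFeasible_greedy _ isFeasible_empty))
  · simpa [totalProfit] using hc ∅ isFeasible_empty
  · obtain ⟨hI, hi⟩ := mem_allItems.1 hc'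
    simpa [totalProfit] using hc _ (hP.isFeasible_singleton hI hi)

namespace Dominates

theorem refl (S : Finset ι) : P.Dominates ε S S := ⟨le_rfl, le_rfl⟩

theorem trans (h : P.Dominates ε S S') (h' : P.Dominates ε S' T) : P.Dominates ε S T :=
  ⟨h'.1.trans h.1, h.2.trans h'.2⟩

theorem insert (h : P.Dominates ε S S') (hi : i ∉ S) (hi' : i ∉ S') :
    P.Dominates ε (insert i S) (insert i S') := by
  simp only [Dominates, scaledProfit, totalSize, Finset.sum_insert hi,
    Finset.sum_insert hi'] at h ⊢
  exact ⟨Nat.add_le_add_left h.1 _, by linarith [h.2]⟩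

end Dominates

/-- Some state of the list `L` dominates `S`, so that the dynamic program may forget `S`. -/
def Covers (P : MCKS1 ι) (ε : ℝ) (L : List (Finset ι)) (S : Finset ι) : Prop :=
  ∃ T ∈ L, P.Dominates ε T S

theorem Covers.trans_dominates (h : P.Covers ε L S) (hd : P.Dominates ε S S') :
    P.Covers ε L S' := by
  obtain ⟨T, hT, hTS⟩ := h
  exact ⟨T, hT, hTS.trans hd⟩

theorem Covers.insertState (h : P.Covers ε L S) (U : Finset ι) :
    P.Covers ε (P.insertState ε L U) S := by
  obtain ⟨T, hT, hTS⟩ := h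
  rw [MCKS1.insertState]
  split_ifs
  · exact ⟨T, hT, hTS⟩
  · by_cases hUT : P.Dominates ε U T
    · exact ⟨U, List.mem_cons_self, hUT.trans hTS⟩
    · exact ⟨T, List.mem_cons_of_mem _ (List.mem_filter.2 ⟨hT, by simpa using hUT⟩), hTS⟩

theorem covers_insertState_self (L : List (Finset ι)) (hS : P.totalSize S ≤ 1) :
    P.Covers ε (P.insertState ε L S) S := by
  rw [insertState]
  split_ifs with h
  · exact h.resolve_left hS.not_gt
  · exact ⟨S, List.mem_cons_self, Dominates.refl S⟩

theorem Covers.foldl_insertState (h : P.Covers ε L S) (C : List (Finset ι)) :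
    P.Covers ε (C.foldl (P.insertState ε) L) S := by
  induction C generalizing L with
  | nil => exact h
  | cons U _ ih => exact ih (h.insertState U)

theorem covers_foldl_insertState (hS : S ∈ C) (hsize : P.totalSize S ≤ 1) :
    P.Covers ε (C.foldl (P.insertState ε) L) S := by
  induction C generalizing L with
  | nil => exact absurd hS List.not_mem_nil
  | cons U C ih =>
    rcases List.mem_cons.1 hS with rfl | hS
    · exact (covers_insertState_self L hsize).foldl_insertState C
    · exact ih hS

theorem mem_insertState (h : S ∈ P.insertState ε L T) : S ∈ L ∨ S = T ∧ P.totalSize S ≤ 1 := by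
  rw [insertState] at h
  split_ifs at h with hT
  · exact Or.inl h
  · rcases List.mem_cons.1 h with rfl | h
    · exact Or.inr ⟨rfl, not_lt.1 fun hlt => hT (Or.inl hlt)⟩
    · exact Or.inl (List.mem_of_mem_filter h)

theorem mem_foldl_insertState (h : S ∈ C.foldl (P.insertState ε) L) :
    S ∈ L ∨ S ∈ C ∧ P.totalSize S ≤ 1 := by
  induction C generalizing L with
  | nil => exact Or.inl h
  | cons T C ih =>
    rcases ih h with h | ⟨h, hsize⟩
    · exact (mem_insertState h).imp_right fun ⟨hST, hsize⟩ =>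
        ⟨List.mem_cons.2 (Or.inl hST), hsize⟩
    · exact Or.inr ⟨List.mem_cons_of_mem _ h, hsize⟩

theorem mem_stage_candidates :
    S ∈ L ++ L.flatMap (fun T => I.toList.map fun i => insert i T) ↔
      S ∈ L ∨ ∃ T ∈ L, ∃ i ∈ I, S = insert i T := by
  simp only [List.mem_append, List.mem_flatMap, List.mem_map, Finset.mem_toList, eq_comm]

theorem mem_stage (h : S ∈ P.stage ε L I) :
    P.totalSize S ≤ 1 ∧ (S ∈ L ∨ ∃ T ∈ L, ∃ i ∈ I, S = insert i T) := by
  obtain ⟨hS, hsize⟩ := (mem_foldl_insertState h).resolve_left List.not_mem_nil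
  exact ⟨hsize, mem_stage_candidates.1 hS⟩

theorem covers_stage (hsize : P.totalSize S ≤ 1)
    (h : S ∈ L ∨ ∃ T ∈ L, ∃ i ∈ I, S = insert i T) : P.Covers ε (P.stage ε L I) S :=
  covers_foldl_insertState (mem_stage_candidates.2 h) hsize

/-- The invariant of the dynamic program: `L` is a correct table for the itemsets `Q`, in that all
its states are feasible and use items of `Q` only, and it covers every such solution. -/
structure IsTable (P : MCKS1 ι) (ε : ℝ) (Q : Finset (Finset ι)) (L : List (Finset ι)) :
    Prop where
  isFeasible : ∀ S ∈ L, P.IsFeasible S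
  subset : ∀ S ∈ L, S ⊆ Q.biUnion id
  covers : ∀ S, P.IsFeasible S → S ⊆ Q.biUnion id → P.Covers ε L S

theorem isTable_empty : P.IsTable ε ∅ [∅] where
  isFeasible := List.forall_mem_singleton.2 isFeasible_empty
  subset := List.forall_mem_singleton.2 (Finset.empty_subset _)
  covers S _ hS := by
    obtain rfl := Finset.subset_empty.1 hS
    exact ⟨∅, List.mem_cons_self, Dominates.refl ∅⟩

namespace IsValid

variable {Q : Finset (Finset ι)}

theorem isFeasible_of_mem_stage (hP : P.IsValid) (hL : P.IsTable ε Q L) (hI : I ∈ P.itemsets)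
    (hQ : Disjoint (Q.biUnion id) I) (hS : S ∈ P.stage ε L I) : P.IsFeasible S := by
  obtain ⟨hsize, hSL | ⟨T, hT, i, hi, rfl⟩⟩ := mem_stage hS
  · exact hL.isFeasible S hSL
  · exact ⟨(hL.isFeasible T hT).1.insert hP.disjoint hI hi
      (hQ.mono_left (hL.subset T hT)), hsize⟩

theorem covers_stage_of_isTable (hP : P.IsValid) (hL : P.IsTable ε Q L) (hI : I ∈ P.itemsets)
    (hQ : Disjoint (Q.biUnion id) I) (hS : P.IsFeasible S) (hSQ : S ⊆ I ∪ Q.biUnion id) :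
    P.Covers ε (P.stage ε L I) S := by
  obtain ⟨T, hT, hTS⟩ := hL.covers (S \ I) (hP.isFeasible_mono hS Finset.sdiff_subset)
    (sdiff_le_iff.2 hSQ)
  rcases hS.1.sdiff_eq_or_exists_eq_insert_sdiff hI with hSI | ⟨i, hi, hSi⟩
  · rw [hSI] at hTS
    exact (covers_stage (hTS.2.trans hS.2) (Or.inl hT)).trans_dominates hTS
  · have hiT : i ∉ T := fun h => Finset.disjoint_left.1 hQ (hL.subset T hT h) hi
    have hins : P.Dominates ε (insert i T) S :=
      hSi ▸ hTS.insert hiT fun h => (Finset.mem_sdiff.1 h).2 hi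
    exact (covers_stage (hins.2.trans hS.2) (Or.inr ⟨T, hT, i, hi, rfl⟩)).trans_dominates hins

theorem isTable_stage (hP : P.IsValid) (hL : P.IsTable ε Q L) (hI : I ∈ P.itemsets)
    (hQ : Disjoint (Q.biUnion id) I) : P.IsTable ε (insert I Q) (P.stage ε L I) where
  isFeasible _ hS := hP.isFeasible_of_mem_stage hL hI hQ hS
  subset S hS := by
    rw [Finset.biUnion_insert]
    obtain ⟨-, hSL | ⟨T, hT, i, hi, rfl⟩⟩ := mem_stage hS
    · exact (hL.subset S hSL).trans Finset.subset_union_right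
    · exact Finset.insert_subset (Finset.mem_union_left _ hi)
        ((hL.subset T hT).trans Finset.subset_union_right)
  covers S hS hSQ := by
    rw [Finset.biUnion_insert] at hSQ
    exact hP.covers_stage_of_isTable hL hI hQ hS hSQ

theorem isTable_foldl_stage (hP : P.IsValid) {l : List (Finset ι)} (hl : ∀ I ∈ l, I ∈ P.itemsets)
    (hnodup : l.Nodup) : P.IsTable ε l.toFinset (l.foldl (P.stage ε) [∅]) := by
  induction l using List.reverseRecOn with
  | nil => exact isTable_empty
  | append_singleton l I ih =>
    obtain ⟨hl, hI⟩ := List.forall_mem_append.1 hl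
    obtain ⟨hnodup, -, hne⟩ := List.nodup_append.1 hnodup
    rw [List.forall_mem_singleton] at hI
    have hdis : Disjoint (l.toFinset.biUnion id) I :=
      (Finset.disjoint_biUnion_left _ _ _).2 fun I' hI' =>
        hP.disjoint I' (hl I' (List.mem_toFinset.1 hI')) I hI
          (hne I' (List.mem_toFinset.1 hI') I (List.mem_singleton_self I))
    rw [List.foldl_append, List.toFinset_append, Finset.union_comm]
    exact hP.isTable_stage (ih hl hnodup) hI hdis

theorem isTable_itemsets (hP : P.IsValid) :
    P.IsTable ε P.itemsets (P.itemsets.toList.foldl (P.stage ε) [∅]) := by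
  simpa using hP.isTable_foldl_stage (ε := ε) (fun _ => Finset.mem_toList.1)
    P.itemsets.nodup_toList

theorem lawler_mem_argmax (hP : P.IsValid) :
    P.lawler ε ∈ (P.itemsets.toList.foldl (P.stage ε) [∅]).argmax (P.scaledProfit ε) := by
  obtain ⟨T, hT, -⟩ := (hP.isTable_itemsets (ε := ε)).covers ∅ isFeasible_empty
    (Finset.empty_subset _)
  rw [lawler]
  cases h : (P.itemsets.toList.foldl (P.stage ε) [∅]).argmax (P.scaledProfit ε) with
  | none => exact absurd (List.argmax_eq_none.1 h ▸ hT) List.not_mem_nil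
  | some S => exact rfl

theorem isFeasible_lawler (hP : P.IsValid) : P.IsFeasible (P.lawler ε) :=
  hP.isTable_itemsets.isFeasible _ (List.argmax_mem hP.lawler_mem_argmax)

theorem scaledProfit_le_scaledProfit_lawler (hP : P.IsValid) (hS : P.IsFeasible S) :
    P.scaledProfit ε S ≤ P.scaledProfit ε (P.lawler ε) := by
  obtain ⟨T, hT, hTS⟩ := hP.isTable_itemsets.covers S hS hS.1.1
  exact hTS.1.trans (List.le_of_mem_argmax hT hP.lawler_mem_argmax)

end IsValid

theorem scale_nonneg (hε : 0 ≤ ε) : 0 ≤ P.scale ε :=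
  div_nonneg (mul_nonneg hε lowerBound_nonneg) (Nat.cast_nonneg _)

theorem scale_mul_card_le (hε : 0 ≤ ε) (hS : IsChoice P.itemsets S) :
    P.scale ε * S.card ≤ ε * P.lowerBound :=
  calc P.scale ε * S.card ≤ P.scale ε * P.itemsets.card :=
        mul_le_mul_of_nonneg_left (Nat.cast_le.2 hS.card_le) (scale_nonneg hε)
    _ ≤ ε * P.lowerBound :=
        by
        rw [scale, div_mul_eq_mul_div]
        exact div_le_of_le_mul₀ (Nat.cast_nonneg _) (mul_nonneg hε lowerBound_nonneg) le_rfl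

theorem profit_le_scale_mul (hε : 0 < ε) (hI : I ∈ P.itemsets) (hi : i ∈ I) :
    P.profit i ≤ P.scale ε * (⌊P.profit i / P.scale ε⌋₊ + 1) := by
  rcases (scale_nonneg (P := P) hε.le).eq_or_lt with hK | hK
  · have hcard : (P.itemsets.card : ℝ) ≠ 0 := Nat.cast_ne_zero.2 (Finset.card_ne_zero_of_mem hI)
    have hbound : P.lowerBound = 0 :=
      (mul_eq_zero.1 ((div_eq_zero_iff.1 hK.symm).resolve_right hcard)).resolve_left hε.ne'
    rw [← hK, zero_mul, ← hbound]
    exact profit_le_lowerBound hI hi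
  · exact le_mul_floor_div_add_one hK _

theorem totalProfit_le_scale_mul_add (hε : 0 < ε) (hS : IsChoice P.itemsets S) :
    P.totalProfit S ≤ P.scale ε * P.scaledProfit ε S + ε * P.lowerBound :=
  calc P.totalProfit S
      ≤ ∑ i ∈ S, P.scale ε * (⌊P.profit i / P.scale ε⌋₊ + 1) := Finset.sum_le_sum fun i hi => by
        obtain ⟨I, hI, hiI⟩ := hS.exists_mem hi
        exact profit_le_scale_mul hε hI hiI
    _ = P.scale ε * P.scaledProfit ε S + P.scale ε * S.card := by
        rw [← Finset.mul_sum, Finset.sum_add_distrib, mul_add, scaledProfit, Nat.cast_sum,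
          Finset.sum_const, nsmul_one]
    _ ≤ P.scale ε * P.scaledProfit ε S + ε * P.lowerBound := by
        linarith [scale_mul_card_le hε.le hS]

namespace IsValid

theorem scale_mul_scaledProfit_le (hP : P.IsValid) (hε : 0 ≤ ε) (hS : IsChoice P.itemsets S) :
    P.scale ε * P.scaledProfit ε S ≤ P.totalProfit S := by
  rw [scaledProfit, Nat.cast_sum, Finset.mul_sum]
  exact Finset.sum_le_sum fun i hi =>
    mul_floor_div_le (scale_nonneg hε) (hP.profit_nonneg_of_isChoice hS hi)

theorem totalProfit_le_lawler_add (hP : P.IsValid) (hε : 0 < ε) (hS : P.IsFeasible S) :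
    P.totalProfit S ≤ P.totalProfit (P.lawler ε) + ε * P.lowerBound :=
  calc P.totalProfit S ≤ P.scale ε * P.scaledProfit ε S + ε * P.lowerBound :=
        totalProfit_le_scale_mul_add hε hS.1
    _ ≤ P.scale ε * P.scaledProfit ε (P.lawler ε) + ε * P.lowerBound := by
        have hK : 0 ≤ P.scale ε := scale_nonneg hε.le
        have hopt := hP.scaledProfit_le_scaledProfit_lawler (ε := ε) hS
        gcongr
    _ ≤ P.totalProfit (P.lawler ε) + ε * P.lowerBound := by
        gcongr
        exact hP.scale_mul_scaledProfit_le hε.le hP.isFeasible_lawler.1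

theorem isApproxSolution_lawler (hP : P.IsValid) (hε : 0 < ε) (hε1 : ε ≤ 1) :
    P.IsApproxSolution (1 - ε) (P.lawler ε) := by
  refine ⟨hP.isFeasible_lawler, fun S hS => ?_⟩
  have hadd : ∀ S, P.IsFeasible S → _ := fun _ => hP.totalProfit_le_lawler_add hε
  have hbound : (1 - ε) * P.lowerBound ≤ P.totalProfit (P.lawler ε) := by
    linarith [hP.lowerBound_le hadd]
  calc (1 - ε) * P.totalProfit S
      ≤ (1 - ε) * (P.totalProfit (P.lawler ε) + ε * P.lowerBound) :=
        mul_le_mul_of_nonneg_left (hadd S hS) (sub_nonneg.2 hε1)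
    _ = (1 - ε) * P.totalProfit (P.lawler ε) + ε * ((1 - ε) * P.lowerBound) := by ring
    _ ≤ (1 - ε) * P.totalProfit (P.lawler ε) + ε * P.totalProfit (P.lawler ε) := by gcongr
    _ = P.totalProfit (P.lawler ε) := by ring

end IsValid

end MCKS1

/-! ### The reduction to dimension one -/

section Reduction

variable {ι : Type*} {d m : ℕ}

theorem cuboidVol_le_one {x : Fin d → ℝ} (hx : x ∈ Set.Icc 0 1) : cuboidVol x ≤ 1 :=
  Finset.prod_le_one (fun j _ => hx.1 j) fun j _ => hx.2 j

theorem cuboidVol_mapBase (g : ℝ → ℝ) (x : Fin (m + 1) → ℝ) :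
    cuboidVol (mapBase g x) = (∏ j : Fin m, g (x j.castSucc)) * x (Fin.last m) := by
  simp [cuboidVol, mapBase, Fin.prod_univ_castSucc, (Fin.castSucc_lt_last _).ne]

theorem cuboidVol_mapBase_harmonicH_three (len : ι → Fin (m + 1) → ℝ) (i : ι) :
    cuboidVol (mapBase (harmonicH 3) (len i)) =
      baseWeight 3 len i * len i (Fin.last m) / 3 ^ m := by
  rw [cuboidVol_mapBase, mul_div_right_comm]
  simp only [harmonicH_three, Finset.prod_div_distrib, Finset.prod_const, Finset.card_univ,
    Fintype.card_fin, baseWeight, cuboidVol, baseLen]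

theorem cuboidVol_mapBase_mem_Icc {g : ℝ → ℝ} {x : Fin (m + 1) → ℝ} (hx : 0 ≤ x (Fin.last m))
    (hg : ∀ j : Fin m, g (x j.castSucc) ∈ Set.Icc 0 (x j.castSucc)) :
    cuboidVol (mapBase g x) ∈ Set.Icc 0 (cuboidVol x) := by
  rw [cuboidVol_mapBase, cuboidVol, Fin.prod_univ_castSucc]
  exact ⟨mul_nonneg (Finset.prod_nonneg fun j _ => (hg j).1) hx,
    mul_le_mul_of_nonneg_right (Finset.prod_le_prod (fun j _ => (hg j).1) fun j _ => (hg j).2) hx⟩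

theorem cuboidVol_mapBase_harmonicH_three_mem_Icc {x : Fin (m + 1) → ℝ} (hx : x ∈ Set.Icc 0 1) :
    cuboidVol (mapBase (harmonicH 3) x) ∈ Set.Icc 0 (cuboidVol x) :=
  cuboidVol_mapBase_mem_Icc (hx.1 _) fun _ => harmonicH_three_mem_Icc ⟨hx.1 _, hx.2 _⟩

namespace MCKS.IsValid

theorem len_mem_Icc {P : MCKS ι d} (hP : P.IsValid) {I : Finset ι} (hI : I ∈ P.itemsets) {i : ι}
    (hi : i ∈ I) : P.len i ∈ Set.Icc 0 1 :=
  ⟨fun j => (hP.len_pos I hI i hi j).le, hP.len_le_one I hI i hi⟩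

theorem reduce {P : MCKS ι (m + 1)} (hP : P.IsValid) : P.reduce.IsValid where
  disjoint := hP.disjoint
  size_nonneg _ hI _ hi := (cuboidVol_mapBase_harmonicH_three_mem_Icc (hP.len_mem_Icc hI hi)).1
  size_le_one _ hI _ hi :=
    (cuboidVol_mapBase_harmonicH_three_mem_Icc (hP.len_mem_Icc hI hi)).2.trans
      (cuboidVol_le_one (hP.len_mem_Icc hI hi))
  profit_nonneg := hP.profit_nonneg

variable [DecidableEq ι]

theorem len_mem_Icc_of_isChoice {P : MCKS ι d} (hP : P.IsValid) {S : Finset ι}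
    (hS : IsChoice P.itemsets S) {i : ι} (hi : i ∈ S) : P.len i ∈ Set.Icc 0 1 := by
  obtain ⟨I, hI, hiI⟩ := hS.exists_mem hi
  exact hP.len_mem_Icc hI hiI

theorem isFeasible_reduce {P : MCKS ι (m + 1)} (hP : P.IsValid) {B : PackedBin ι (m + 1)}
    (hB : P.IsFeasible B) : P.reduce.IsFeasible B.items := by
  have hlen : ∀ i ∈ B.items, P.len i ∈ Set.Icc 0 1 := fun _ => hP.len_mem_Icc_of_isChoice hB.1
  refine ⟨hB.1, ?_⟩
  calc P.reduce.totalSize B.items ≤ ∑ i ∈ B.items, cuboidVol (P.len i) :=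
        Finset.sum_le_sum fun i hi => (cuboidVol_mapBase_harmonicH_three_mem_Icc (hlen i hi)).2
    _ ≤ 1 := hB.2.sum_cuboidVol_le_one fun i hi => (hlen i hi).1

end MCKS.IsValid

end Reduction

/-! ### A most profitable bin -/

section MostProfitable

variable {ι : Type*} {d : ℕ} {len : ι → Fin d → ℝ} {profit : ι → ℝ} {J : Finset ι}
  {L : List (PackedBin ι d)} {B : PackedBin ι d}

theorem mostProfitable_mem_or_eq (profit : ι → ℝ) (L : List (PackedBin ι d)) :
    mostProfitable profit L ∈ L ∨ mostProfitable profit L = { items := ∅, pos := 0 } := by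
  rw [mostProfitable]
  cases h : L.argmax fun B => ∑ i ∈ B.items, profit i with
  | none => exact Or.inr rfl
  | some B => exact Or.inl (List.argmax_mem h)

theorem le_mostProfitable (profit : ι → ℝ) (hB : B ∈ L) :
    ∑ i ∈ B.items, profit i ≤ ∑ i ∈ (mostProfitable profit L).items, profit i := by
  rw [mostProfitable]
  cases h : L.argmax fun B => ∑ i ∈ B.items, profit i with
  | none => exact absurd (List.argmax_eq_none.1 h ▸ hB) List.not_mem_nil
  | some B' => exact List.le_of_mem_argmax hB h

namespace IsBinPacking

theorem items_subset (h : IsBinPacking len J L) (hB : B ∈ L) : B.items ⊆ J :=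
  fun i hi => (h.2.2 i).2 ⟨B, hB, hi⟩

theorem sdiff_of_cons [DecidableEq ι] (h : IsBinPacking len J (B :: L)) :
    IsBinPacking len (J \ B.items) L := by
  obtain ⟨hpack, hdis, hmem⟩ := h
  rw [List.pairwise_cons] at hdis
  refine ⟨(List.forall_mem_cons.1 hpack).2, hdis.2, fun i => ?_⟩
  simp only [Finset.mem_sdiff, hmem i, List.mem_cons, exists_eq_or_imp]
  refine ⟨fun ⟨h, hB⟩ => h.resolve_left hB, fun h => ⟨Or.inr h, fun hiB => ?_⟩⟩
  obtain ⟨B', hB', hiB'⟩ := h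
  exact Finset.disjoint_left.1 (hdis.1 B' hB') hiB hiB'

theorem sum_eq (h : IsBinPacking len J L) (f : ι → ℝ) :
    ∑ i ∈ J, f i = (L.map fun B => ∑ i ∈ B.items, f i).sum := by
  classical
  induction L generalizing J with
  | nil =>
    obtain rfl : J = ∅ := Finset.eq_empty_of_forall_notMem fun i hi => by
      simpa using (h.2.2 i).1 hi
    rfl
  | cons B L ih =>
    rw [List.map_cons, List.sum_cons, ← ih h.sdiff_of_cons, add_comm,
      Finset.sum_sdiff (h.items_subset List.mem_cons_self)]

theorem sum_le_length_mul_mostProfitable (h : IsBinPacking len J L) (profit : ι → ℝ) :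
    ∑ i ∈ J, profit i ≤ L.length * ∑ i ∈ (mostProfitable profit L).items, profit i :=
  (h.sum_eq profit).trans_le (sum_map_le_length_mul fun _ => le_mostProfitable profit)

theorem items_mostProfitable_subset (h : IsBinPacking len J L) (profit : ι → ℝ) :
    (mostProfitable profit L).items ⊆ J := by
  rcases mostProfitable_mem_or_eq profit L with hmem | heq
  · exact h.items_subset hmem
  · exact heq ▸ Finset.empty_subset J

theorem isPacking_mostProfitable (h : IsBinPacking len J L) (profit : ι → ℝ) :
    IsPacking len (mostProfitable profit L).items (mostProfitable profit L).pos := by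
  rcases mostProfitable_mem_or_eq profit L with hmem | heq
  · exact h.1 _ hmem
  · rw [heq]
    exact ⟨by simp, by simp⟩

end IsBinPacking

variable [DecidableEq ι]

theorem MCKS.isApproxSolution_mostProfitable {P : MCKS ι d} (hJ : IsChoice P.itemsets J)
    (hprofit : ∀ i ∈ J, 0 ≤ P.profit i) (hL : IsBinPacking P.len J L) {n : ℕ} (hn : 0 < n)
    (hlength : L.length ≤ n) {α : ℝ}
    (hα : ∀ B, P.IsFeasible B → α * ∑ i ∈ B.items, P.profit i ≤ ∑ i ∈ J, P.profit i) :
    P.IsApproxSolution (α / n) (mostProfitable P.profit L) := by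
  have hsub := hL.items_mostProfitable_subset P.profit
  refine ⟨⟨hJ.mono hsub, hL.isPacking_mostProfitable P.profit⟩, fun B hB => ?_⟩
  rw [div_mul_eq_mul_div, div_le_iff₀ (Nat.cast_pos.2 hn), mul_comm (∑ i ∈ _, _)]
  calc α * ∑ i ∈ B.items, P.profit i ≤ ∑ i ∈ J, P.profit i := hα B hB
    _ ≤ L.length * ∑ i ∈ (mostProfitable P.profit L).items, P.profit i :=
        hL.sum_le_length_mul_mostProfitable P.profit
    _ ≤ n * ∑ i ∈ (mostProfitable P.profit L).items, P.profit i := by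
        have := Finset.sum_nonneg fun i hi => hprofit i (hsub hi)
        gcongr

end MostProfitable

/-! ### The approximation guarantee -/

namespace MCKS.IsValid

variable {ι : Type*} [DecidableEq ι] {m : ℕ} {P : MCKS ι (m + 2)} {J : Finset ι}

theorem isBinPacking_hdhNF_toList (hP : P.IsValid) (hJ : IsChoice P.itemsets J) :
    IsBinPacking P.len J (hdhNF 3 P.len J.toList) := by
  have hlen : ∀ i ∈ J.toList, P.len i ∈ Set.Icc 0 1 := fun i hi =>
    hP.len_mem_Icc_of_isChoice hJ (Finset.mem_toList.1 hi)
  simpa using isBinPacking_hdhNF le_rfl hlen J.nodup_toList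

theorem length_hdhNF_toList_le (hP : P.IsValid) (hJ : P.reduce.IsFeasible J) :
    (hdhNF 3 P.len J.toList).length ≤ 3 ^ (m + 2) := by
  have hlen : ∀ i ∈ J.toList, P.len i ∈ Set.Icc 0 1 := fun i hi =>
    hP.len_mem_Icc_of_isChoice hJ.1 (Finset.mem_toList.1 hi)
  have hsize : (J.toList.map fun i => baseWeight 3 P.len i * P.len i (Fin.last _)).sum ≤
      3 ^ (m + 1) := by
    have hJsize := hJ.2
    simp only [MCKS1.totalSize, MCKS.reduce, cuboidVol_mapBase_harmonicH_three] at hJsize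
    rwa [← Finset.sum_div, div_le_one (by positivity), ← Finset.sum_map_toList] at hJsize
  calc (hdhNF 3 P.len J.toList).length ≤ 3 ^ (m + 1) + 2 * 3 ^ (m + 1) :=
        length_hdhNF_le le_rfl hlen (by positivity) (by push_cast; linarith)
    _ = 3 ^ (m + 2) := by ring

theorem isApproxSolution_packBest (hP : P.IsValid) {α : ℝ}
    (hJ : P.reduce.IsApproxSolution α J) :
    P.IsApproxSolution (α / 3 ^ (m + 2)) (P.packBest J) := by
  simpa [packBest] using isApproxSolution_mostProfitable hJ.1.1
    (fun _ => hP.reduce.profit_nonneg_of_isChoice hJ.1.1) (hP.isBinPacking_hdhNF_toList hJ.1.1)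
    (by positivity) (hP.length_hdhNF_toList_le hJ.1) fun _ hB => hJ.2 _ (hP.isFeasible_reduce hB)

end MCKS.IsValid

end

/-- Dimension `d = m + 2 ≥ 2`. -/
theorem mainTheorem5 {ι : Type*} [DecidableEq ι] (m : ℕ) (P : MCKS ι (m + 2)) (hP : P.IsValid)
    (ε : ℝ) (hε0 : 0 < ε) (hε1 : ε < 1) :
    P.IsApproxSolution ((1 - ε) / 3 ^ (m + 2)) (P.hdhKS ε) ∧
      P.reduce.IsApproxSolution (1 - ε) (P.reduce.lawler ε) ∧
      ∀ J : Finset ι, P.reduce.IsApproxSolution (1 - ε) J →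
        IsBinPacking P.len J (hdhNF 3 P.len J.toList) ∧
        (hdhNF 3 P.len J.toList).length ≤ 3 ^ (m + 2) ∧
        P.IsApproxSolution ((1 - ε) / 3 ^ (m + 2)) (P.packBest J) := by
  have hlawler : P.reduce.IsApproxSolution (1 - ε) (P.reduce.lawler ε) :=
    hP.reduce.isApproxSolution_lawler hε0 hε1.le
  refine ⟨hP.isApproxSolution_packBest hlawler, hlawler, fun J hJ => ⟨?_, ?_, ?_⟩⟩
  · exact hP.isBinPacking_hdhNF_toList hJ.1.1
  · exact hP.length_hdhNF_toList_le hJ.1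
  · exact hP.isApproxSolution_packBest hJ
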